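/- **Conventions.** A pair $(\Gamma,\Gamma_0)$ of a group and a subgroup is a Hecke pair if every double coset $\Gamma_0\gamma\Gamma_0$ is a finite union of left cosets $\gamma_i\Gamma_0$. Its Hecke algebra $\mathcal H(\Gamma,\Gamma_0)$ is the unital $*$-algebra of $\Gamma_0$-biinvariant functions $\Gamma\to\mathbb C$ supported in finitely many double cosets, with $f*g(\gamma)=\sum_{\gamma_1\in\Gamma_0\backslash\Gamma}f(\gamma\gamma_1^{-1})g(\gamma_1)$ and $f^*(\gamma)=\overline{f(\gamma^{-1})}$. Write $[\gamma]$ for the characteristic function of $\Gamma_0\gamma\Gamma_0$ and $R(\gamma)=|\Gamma_0\backslash\Gamma_0\gamma\Gamma_0|$. The universal C*-algebra $C^*_u(\Gamma,\Gamma_0)$ is the universal enveloping C*-algebra of $\mathcal H(\Gamma,\Gamma_0)$ (if it exists): a unital C*-algebra with a unital $*$-homomorphism from $\mathcal H(\Gamma,\Gamma_0)$ with dense range, through which every unital $*$-homomorphism of $\mathcal H(\Gamma,\Gamma_0)$ to a unital C*-algebra factors. For an action $\alpha$ of a semigroup $S$ (with identity) by, not necessarily unital, $*$-endomorphisms of a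 unital $*$-algebra (C*-algebra) $A$, a covariant representation is a pair $(\pi,V)$ of a unital $*$-homomorphism $\pi$ of $A$ and a unital homomorphism $V$ of $S$ to a unital $*$-algebra (C*-algebra) such that $V_s^*V_s=1$ and $\pi(\alpha_s(a))=V_s\pi(a)V_s^*$; the semigroup crossed product $A\rtimes_\alpha S$ is the unital $*$-algebra (C*-algebra) generated by a universal covariant representation, i.e. one through which every covariant representation factors. **Statement.** Let $\mathcal K$ be an imaginary quadratic field with ring of integers $\mathcal O$ and unit group $\mathcal O^*$. Let $\Gamma=\mathcal K\rtimes\mathcal K^*$ be the group of matrices $\begin{pmatrix}1&y\\0&x\end{pmatrix}$ with $y\in\mathcal K$, $x\in\mathcal K^*$ (equivalently, the semidirect product in which $x\in\mathcal K^*$ acts on $\mathcal K$ as multiplication by $x^{-1}$). Let $N=\mathcal K\rtimes\mathcal O^*$ be the normal subgroup of those with $x\in\mathcal O^*$, and $\Gamma_0=\mathcal O\rtimes\mathcal O^*$ the subgroup of those with $x\in\mathcal O^*$ and $y\in\mathcal O$. Let $\mathcal O^\times=\mathcal O\setminus\{0\}$, let $S=\mathcal O^\times/\mathcal O^*$ be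 the multiplicative semigroup of nonzero principal integral ideals, and write $s_a=\begin{pmatrix}1&0\\0&a\end{pmatrix}$ for $a\in\mathcal O^\times$. Then: 1. $(\Gamma,\Gamma_0)$ and $(N,\Gamma_0)$ are Hecke pairs. 2. There is an action $\alpha$ of $S$ by $*$-endomorphisms of $\mathcal H(N,\Gamma_0)$ such that, for all $a\in\mathcal O^\times$, $f\in\mathcal H(N,\Gamma_0)$ and $y\in N$, $\alpha_{a\mathcal O^*}(f)(y)=R(s_a)^{-1}f(s_a^{-1}ys_a)$. Moreover $$\mathcal H(\mathcal K\rtimes\mathcal K^*,\mathcal O\rtimes\mathcal O^*)\cong\mathcal H(\mathcal K\rtimes\mathcal O^*,\mathcal O\rtimes\mathcal O^*)\rtimes_\alpha(\mathcal O^\times/\mathcal O^*)$$ as $*$-algebras. The isomorphism is canonical: $\mathcal H(\Gamma,\Gamma_0)$ is the $*$-algebraic semigroup crossed product, with the covariant representation given by extension of functions by zero $\mathcal H(N,\Gamma_0)\to\mathcal H(\Gamma,\Gamma_0)$ and by the isometries $\mu_{a\mathcal O^*}=R(s_a)^{-1/2}[s_a]$. 3. $C^*_u(N,\Gamma_0)$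 and $C^*_u(\Gamma,\Gamma_0)$ exist, $\alpha$ extends to an action of $S$ by $*$-endomorphisms of $C^*_u(N,\Gamma_0)$, again denoted $\alpha$, and $$C^*_u(\Gamma,\Gamma_0)\cong C^*_u(N,\Gamma_0)\rtimes_\alpha(\mathcal O^\times/\mathcal O^*),$$ canonically, by the extension of the isomorphism in 2. -/

import Mathlib

open scoped nonZeroDivisors NumberField

universe u v

/-! ### Hecke pairs -/

/-- `(G, H)` is a Hecke pair: every double coset `H γ H` is a finite union of left cosets `γᵢ H`. -/
class IsHeckePair {G : Type*} [Group G] (H : Subgroup G) : Prop where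
  finite_leftCosets : ∀ γ : G,
    ((fun x : G => (x : G ⧸ H)) '' DoubleCoset.doubleCoset γ (H : Set G) (H : Set G)).Finite

/-- The set `H \ G` of right cosets `H γ`. -/
abbrev RightCosets {G : Type*} [Group G] (H : Subgroup G) : Type _ :=
  Quotient (QuotientGroup.rightRel H)

/-- The right coset `H γ`. -/
def toRightCoset {G : Type*} [Group G] (H : Subgroup G) (γ : G) : RightCosets H :=
  Quotient.mk _ γ

/-- `R(γ)`: the number of right cosets in the double coset `H γ H`. -/
noncomputable def heckeR {G : Type*} [Group G] (H : Subgroup G) (γ : G) : ℕ :=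
  (toRightCoset H '' DoubleCoset.doubleCoset γ (H : Set G) (H : Set G)).ncard

section HeckeAlgebra

variable {G : Type*} [Group G] {H : Subgroup G}

theorem toRightCoset_eq_iff {a b : G} : toRightCoset H a = toRightCoset H b ↔ b * a⁻¹ ∈ H := by
  unfold toRightCoset
  rw [Quotient.eq, QuotientGroup.rightRel_apply]

theorem toRightCoset_out (q : RightCosets H) : toRightCoset H q.out = q := Quotient.out_eq q

theorem exists_out_toRightCoset (a : G) : ∃ h ∈ H, (toRightCoset H a).out = h * a := by
  refine ⟨(toRightCoset H a).out * a⁻¹, ?_, by group⟩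
  exact toRightCoset_eq_iff.1 (toRightCoset_out (toRightCoset H a)).symm

/-- The complex functions on `G` that are `H`-biinvariant and supported in finitely many
double cosets. -/
def heckeSubmodule {G : Type*} [Group G] (H : Subgroup G) : Submodule ℂ (G → ℂ) where
  carrier := {f | (∀ h ∈ H, ∀ x, f (h * x) = f x) ∧ (∀ h ∈ H, ∀ x, f (x * h) = f x) ∧
    (DoubleCoset.mk H H '' Function.support f).Finite}
  zero_mem' := by simp
  add_mem' := by
    rintro f g ⟨hf1, hf2, hf3⟩ ⟨hg1, hg2, hg3⟩
    refine ⟨fun h hh x => by simp [hf1 h hh, hg1 h hh], fun h hh x => by simp [hf2 h hh, hg2 h hh],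
      (hf3.union hg3).subset ?_⟩
    rw [← Set.image_union]
    exact Set.image_mono (Function.support_add f g)
  smul_mem' := by
    rintro c f ⟨hf1, hf2, hf3⟩
    refine ⟨fun h hh x => by simp [hf1 h hh], fun h hh x => by simp [hf2 h hh], hf3.subset ?_⟩
    exact Set.image_mono (Function.support_const_smul_subset c f)

/-- The underlying vector space of the Hecke algebra `𝓗(G, H)`. -/
def HeckeAlgebra {G : Type*} [Group G] (H : Subgroup G) : Type _ := heckeSubmodule H

namespace HeckeAlgebra

noncomputable instance : AddCommGroup (HeckeAlgebra H) :=
  inferInstanceAs (AddCommGroup (heckeSubmodule H))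

noncomputable instance : Module ℂ (HeckeAlgebra H) :=
  inferInstanceAs (Module ℂ (heckeSubmodule H))

instance : FunLike (HeckeAlgebra H) G ℂ where
  coe f := f.1
  coe_injective := fun _ _ h => Subtype.ext h

@[ext] theorem ext {f g : HeckeAlgebra H} (h : ∀ x, f x = g x) : f = g := DFunLike.ext f g h

@[simp] theorem add_apply (f g : HeckeAlgebra H) (x : G) : (f + g) x = f x + g x := rfl
@[simp] theorem zero_apply (x : G) : (0 : HeckeAlgebra H) x = 0 := rfl
@[simp] theorem smul_apply (c : ℂ) (f : HeckeAlgebra H) (x : G) : (c • f) x = c * f x := rfl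

theorem left_inv (f : HeckeAlgebra H) {h : G} (hh : h ∈ H) (x : G) : f (h * x) = f x :=
  f.2.1 h hh x

theorem right_inv (f : HeckeAlgebra H) {h : G} (hh : h ∈ H) (x : G) : f (x * h) = f x :=
  f.2.2.1 h hh x

theorem finite_doubleCosets (f : HeckeAlgebra H) :
    (DoubleCoset.mk H H '' Function.support f).Finite := f.2.2.2

/-- The characteristic function `[γ]` of the double coset `H γ H`. -/
noncomputable def single {G : Type*} [Group G] (H : Subgroup G) (γ : G) : HeckeAlgebra H :=
  ⟨(DoubleCoset.doubleCoset γ (H : Set G) (H : Set G)).indicator 1, by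
    have key : ∀ x, DoubleCoset.mk H H γ = DoubleCoset.mk H H x ↔
        x ∈ DoubleCoset.doubleCoset γ (H : Set G) (H : Set G) := fun x => by
      rw [DoubleCoset.eq, DoubleCoset.mem_doubleCoset]; rfl
    have inv : ∀ x y, DoubleCoset.mk H H x = DoubleCoset.mk H H y →
        (DoubleCoset.doubleCoset γ (H : Set G) (H : Set G)).indicator (1 : G → ℂ) x =
        (DoubleCoset.doubleCoset γ (H : Set G) (H : Set G)).indicator (1 : G → ℂ) y := by
      intro x y hxy
      classical
      simp only [Set.indicator_apply, ← key, hxy]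
      rfl
    refine ⟨fun h hh x => inv _ _ ?_, fun h hh x => inv _ _ ?_,
      (Set.finite_singleton (DoubleCoset.mk H H γ)).subset ?_⟩
    · exact ((DoubleCoset.eq H H _ _).2 ⟨h, hh, 1, H.one_mem, by simp⟩).symm
    · exact ((DoubleCoset.eq H H _ _).2 ⟨1, H.one_mem, h, hh, by simp⟩).symm
    · rintro _ ⟨x, hx, rfl⟩
      have := Set.mem_of_indicator_ne_zero hx
      exact ((key x).2 this).symm⟩

theorem finite_rightCosets [IsHeckePair H] (f : HeckeAlgebra H) :
    {q : RightCosets H | f q.out ≠ 0}.Finite := by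
  have h1 : ∀ d : DoubleCoset.Quotient (H : Set G) H,
      {q : RightCosets H | DoubleCoset.mk H H q.out = d}.Finite := by
    intro d
    have h2 := IsHeckePair.finite_leftCosets (H := H) (d.out)⁻¹
    refine Set.Finite.of_finite_image (f := fun q : RightCosets H => ((q.out⁻¹ : G) : G ⧸ H))
      (h2.subset ?_) ?_
    · rintro _ ⟨q, hq, rfl⟩
      refine ⟨_, ?_, rfl⟩
      rw [Set.mem_ofPred_eq, ← DoubleCoset.out_eq' H H d, DoubleCoset.eq] at hq
      obtain ⟨h, hh, k, hk, e⟩ := hq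
      rw [DoubleCoset.mem_doubleCoset]
      refine ⟨k, hk, h, hh, ?_⟩
      rw [e]; group
    · intro p _ q _ hpq
      have : (q.out * p.out⁻¹) ∈ H := by
        have := QuotientGroup.eq.1 hpq
        simpa using H.inv_mem this
      rw [← toRightCoset_out p, ← toRightCoset_out q]
      exact toRightCoset_eq_iff.2 this
  refine (f.finite_doubleCosets.biUnion fun d _ => h1 d).subset fun q hq => ?_
  simp only [Set.mem_iUnion, Set.mem_ofPred_eq, exists_prop]
  exact ⟨_, ⟨q.out, hq, rfl⟩, rfl⟩

/-- Right translation `H x ↦ H x y` on right cosets. -/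
def translate {G : Type*} [Group G] (H : Subgroup G) (y : G) : RightCosets H ≃ RightCosets H where
  toFun := Quotient.map (fun x => x * y) fun a b h => by
    change QuotientGroup.rightRel H _ _
    replace h : QuotientGroup.rightRel H a b := h
    rw [QuotientGroup.rightRel_apply] at *
    simpa [mul_assoc] using h
  invFun := Quotient.map (fun x => x * y⁻¹) fun a b h => by
    change QuotientGroup.rightRel H _ _
    replace h : QuotientGroup.rightRel H a b := h
    rw [QuotientGroup.rightRel_apply] at *
    simpa [mul_assoc] using h
  left_inv q := by
    induction q using Quotient.inductionOn
    simp
  right_inv q := by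
    induction q using Quotient.inductionOn
    simp

theorem translate_toRightCoset (y x : G) : translate H y (toRightCoset H x) = toRightCoset H (x * y) :=
  rfl

theorem apply_translate {F : G → ℂ} (hF : ∀ h ∈ H, ∀ x, F (h * x) = F x) (y : G)
    (q : RightCosets H) : F (translate H y q).out = F (q.out * y) := by
  conv_lhs => rw [← toRightCoset_out q, translate_toRightCoset]
  obtain ⟨h, hh, e⟩ := exists_out_toRightCoset (H := H) (q.out * y)
  rw [e, hF h hh]

theorem finsum_translate {F : G → ℂ} (hF : ∀ h ∈ H, ∀ x, F (h * x) = F x) (y : G) :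
    ∑ᶠ q : RightCosets H, F (q.out * y) = ∑ᶠ q : RightCosets H, F q.out := by
  rw [← finsum_comp_equiv (translate H y) (f := fun q => F q.out)]
  exact finsum_congr fun q => (apply_translate hF y q).symm

theorem finite_translate [IsHeckePair H] (f : HeckeAlgebra H) (y : G) :
    {q : RightCosets H | f (q.out * y) ≠ 0}.Finite := by
  have := f.finite_rightCosets.preimage (translate H y).injective.injOn
  refine this.subset fun q hq => ?_
  change f (translate H y q).out ≠ 0
  rwa [apply_translate (fun h hh x => f.left_inv hh x)]

/-- The convolution `(f ∗ g)(γ) = ∑_{γ₁ ∈ H \ G} f(γ γ₁⁻¹) g(γ₁)`. By invariance, the summand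
depends only on the coset of `γ₁`, so that any representative can be taken. -/
noncomputable def conv (f g : HeckeAlgebra H) (γ : G) : ℂ :=
  ∑ᶠ q : RightCosets H, f (γ * q.out⁻¹) * g q.out

theorem summand_inv (f g : HeckeAlgebra H) (γ : G) :
    ∀ h ∈ H, ∀ x, f (γ * (h * x)⁻¹) * g (h * x) = f (γ * x⁻¹) * g x := by
  intro h hh x
  rw [g.left_inv hh, mul_inv_rev, ← mul_assoc, f.right_inv (H.inv_mem hh)]

theorem conv_left_inv (f g : HeckeAlgebra H) {h : G} (hh : h ∈ H) (x : G) :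
    conv f g (h * x) = conv f g x :=
  finsum_congr fun q => by rw [mul_assoc, f.left_inv hh]

theorem conv_right_inv (f g : HeckeAlgebra H) {h : G} (hh : h ∈ H) (x : G) :
    conv f g (x * h) = conv f g x := by
  unfold conv
  rw [← finsum_translate (F := fun y => f (x * h * y⁻¹) * g y) (summand_inv f g (x * h)) h]
  refine finsum_congr fun q => ?_
  rw [g.right_inv hh]
  congr 2
  group

theorem conv_finite [IsHeckePair H] (f g : HeckeAlgebra H) :
    (DoubleCoset.mk H H '' Function.support (conv f g)).Finite := by
  have h1 := g.finite_rightCosets.biUnion fun q _ => f.finite_translate (q.out⁻¹)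
  refine (h1.image fun q => DoubleCoset.mk H H q.out).subset ?_
  rintro _ ⟨x, hx, rfl⟩
  obtain ⟨k, hk, e⟩ := exists_out_toRightCoset (H := H) x
  refine ⟨toRightCoset H x, ?_, ?_⟩
  · obtain ⟨q, hq⟩ : ∃ q : RightCosets H, f (x * q.out⁻¹) * g q.out ≠ 0 := by
      by_contra hcon
      push Not at hcon
      exact hx (by unfold conv; simp [hcon])
    simp only [Set.mem_iUnion, Set.mem_ofPred_eq, exists_prop]
    refine ⟨q, right_ne_zero_of_mul hq, ?_⟩
    rw [e, mul_assoc, f.left_inv hk]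
    exact left_ne_zero_of_mul hq
  · exact ((DoubleCoset.eq H H _ _).2 ⟨k, hk, 1, H.one_mem, by simp [e]⟩).symm

noncomputable instance [IsHeckePair H] : Mul (HeckeAlgebra H) where
  mul f g := ⟨conv f g, fun _ hh x => conv_left_inv f g hh x, fun _ hh x => conv_right_inv f g hh x,
    conv_finite f g⟩

/-- The identity is the characteristic function of `H`. -/
noncomputable instance : One (HeckeAlgebra H) where
  one := ⟨(H : Set G).indicator 1, by
    classical
    refine ⟨fun h hh x => ?_, fun h hh x => ?_,
      (Set.finite_singleton (DoubleCoset.mk H H 1)).subset ?_⟩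
    · simp [Set.indicator_apply, H.mul_mem_cancel_left hh]
    · simp [Set.indicator_apply, H.mul_mem_cancel_right hh]
    · rintro _ ⟨x, hx, rfl⟩
      have hx' : x ∈ H := Set.mem_of_indicator_ne_zero hx
      exact ((DoubleCoset.eq H H _ _).2 ⟨x, hx', 1, H.one_mem, by simp⟩).symm⟩

/-- The involution `f^*(γ) = conj (f (γ⁻¹))`. -/
noncomputable instance : Star (HeckeAlgebra H) where
  star f := ⟨fun x => star (f x⁻¹), by
    refine ⟨fun h hh x => ?_, fun h hh x => ?_, ?_⟩
    · simp only [mul_inv_rev, f.right_inv (H.inv_mem hh)]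
    · simp only [mul_inv_rev, f.left_inv (H.inv_mem hh)]
    · refine (f.finite_doubleCosets.image fun d => DoubleCoset.mk H H d.out⁻¹).subset ?_
      rintro _ ⟨x, hx, rfl⟩
      refine ⟨DoubleCoset.mk H H x⁻¹, ⟨x⁻¹, ?_, rfl⟩, ?_⟩
      · intro h0
        exact hx (by simp [h0])
      · obtain ⟨h, k, hh, hk, e⟩ := DoubleCoset.mk_out_eq_mul H H x⁻¹
        refine (DoubleCoset.eq H H _ _).2 ⟨k, hk, h, hh, ?_⟩
        rw [e]; group⟩

theorem mul_apply [IsHeckePair H] (f g : HeckeAlgebra H) (γ : G) :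
    (f * g) γ = ∑ᶠ q : RightCosets H, f (γ * q.out⁻¹) * g q.out := rfl

theorem one_apply (γ : G) : (1 : HeckeAlgebra H) γ = (H : Set G).indicator 1 γ := rfl

theorem star_apply (f : HeckeAlgebra H) (γ : G) : (star f) γ = star (f γ⁻¹) := rfl

theorem single_apply (γ x : G) : single H γ x =
    (DoubleCoset.doubleCoset γ (H : Set G) (H : Set G)).indicator 1 x := rfl

theorem support_finite [IsHeckePair H] (F : G → ℂ) (g : HeckeAlgebra H) :
    (Function.support fun q : RightCosets H => F q.out * g q.out).Finite :=
  g.finite_rightCosets.subset fun _ hq => right_ne_zero_of_mul hq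

theorem mul_assoc' [IsHeckePair H] (f g k : HeckeAlgebra H) : f * g * k = f * (g * k) := by
  ext x
  have hT := k.finite_rightCosets
  have hP := hT.biUnion fun q _ => g.finite_translate (q.out⁻¹)
  set T := hT.toFinset with hTdef
  set P := hP.toFinset with hPdef
  have hin : ∀ q : RightCosets H, (f * g) (x * q.out⁻¹) =
      ∑ᶠ p : RightCosets H, f (x * p.out⁻¹) * g (p.out * q.out⁻¹) := by
    intro q
    rw [mul_apply, ← finsum_translate (F := fun y => f (x * q.out⁻¹ * y⁻¹) * g y)
      (summand_inv f g (x * q.out⁻¹)) (q.out⁻¹)]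
    refine finsum_congr fun p => ?_
    congr 2
    group
  have hq : ∀ q ∈ T, (∑ᶠ p : RightCosets H, f (x * p.out⁻¹) * g (p.out * q.out⁻¹)) =
      ∑ p ∈ P, f (x * p.out⁻¹) * g (p.out * q.out⁻¹) := by
    intro q hqT
    refine finsum_eq_sum_of_support_subset _ fun p hp => ?_
    rw [hPdef, Set.Finite.coe_toFinset]
    simp only [Set.mem_iUnion, Set.mem_ofPred_eq, exists_prop]
    exact ⟨q, by simpa [hTdef] using hqT, right_ne_zero_of_mul hp⟩
  have hk : ∀ a : RightCosets H → ℂ, ∑ᶠ q : RightCosets H, a q * k q.out =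
      ∑ q ∈ T, a q * k q.out := by
    intro a
    refine finsum_eq_sum_of_support_subset _ fun q hq => ?_
    rw [hTdef, Set.Finite.coe_toFinset]
    exact right_ne_zero_of_mul hq
  have hout : (f * (g * k)) x = ∑ p ∈ P, f (x * p.out⁻¹) * (g * k) p.out := by
    rw [mul_apply]
    refine finsum_eq_sum_of_support_subset _ fun p hp => ?_
    have hp' := right_ne_zero_of_mul hp
    rw [mul_apply, hk] at hp'
    obtain ⟨q, hqT, hq0⟩ := Finset.exists_ne_zero_of_sum_ne_zero hp'
    rw [hPdef, Set.Finite.coe_toFinset]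
    simp only [Set.mem_iUnion, Set.mem_ofPred_eq, exists_prop]
    exact ⟨q, right_ne_zero_of_mul hq0, left_ne_zero_of_mul hq0⟩
  rw [hout, mul_apply, hk fun q => (f * g) (x * q.out⁻¹)]
  have h1 : ∀ q ∈ T, (f * g) (x * q.out⁻¹) * k q.out =
      ∑ p ∈ P, f (x * p.out⁻¹) * (g (p.out * q.out⁻¹) * k q.out) := by
    intro q hqT
    rw [hin, hq q hqT, Finset.sum_mul]
    exact Finset.sum_congr rfl fun p _ => mul_assoc _ _ _
  rw [Finset.sum_congr rfl h1, Finset.sum_comm]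
  refine Finset.sum_congr rfl fun p _ => ?_
  rw [mul_apply, hk, Finset.mul_sum]

theorem one_mul' [IsHeckePair H] (f : HeckeAlgebra H) : 1 * f = f := by
  ext x
  rw [mul_apply, finsum_eq_single _ (toRightCoset H x)]
  · obtain ⟨h, hh, e⟩ := exists_out_toRightCoset (H := H) x
    rw [e, f.left_inv hh, one_apply, Set.indicator_of_mem]
    · simp
    · simpa using hh
  · intro q hq
    rw [one_apply, Set.indicator_of_notMem, zero_mul]
    intro hmem
    refine hq ?_
    rw [← toRightCoset_out q]
    exact toRightCoset_eq_iff.2 hmem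

theorem mul_one' [IsHeckePair H] (f : HeckeAlgebra H) : f * 1 = f := by
  ext x
  rw [mul_apply, finsum_eq_single _ (toRightCoset H 1)]
  · obtain ⟨h, hh, e⟩ := exists_out_toRightCoset (H := H) (1 : G)
    rw [mul_one] at e
    rw [e, f.right_inv (H.inv_mem hh), one_apply, Set.indicator_of_mem]
    · simp
    · exact hh
  · intro q hq
    rw [one_apply, Set.indicator_of_notMem, mul_zero]
    intro hmem
    refine hq ?_
    rw [← toRightCoset_out q]
    refine toRightCoset_eq_iff.2 ?_
    simpa using hmem

noncomputable instance [IsHeckePair H] : Ring (HeckeAlgebra H) :=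
  { (inferInstance : AddCommGroup (HeckeAlgebra H)) with
    mul := (· * ·)
    one := 1
    left_distrib := fun f g k => by
      ext x
      simp only [mul_apply, add_apply]
      rw [← finsum_add_distrib (support_finite (fun y => f (x * y⁻¹)) g)
        (support_finite (fun y => f (x * y⁻¹)) k)]
      exact finsum_congr fun q => mul_add _ _ _
    right_distrib := fun f g k => by
      ext x
      simp only [mul_apply, add_apply]
      rw [← finsum_add_distrib (support_finite (fun y => f (x * y⁻¹)) k)
        (support_finite (fun y => g (x * y⁻¹)) k)]
      exact finsum_congr fun q => add_mul _ _ _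
    zero_mul := fun f => by ext x; simp [mul_apply]
    mul_zero := fun f => by ext x; simp [mul_apply]
    mul_assoc := mul_assoc'
    one_mul := one_mul'
    mul_one := mul_one' }

noncomputable instance [IsHeckePair H] : Algebra ℂ (HeckeAlgebra H) :=
  Algebra.ofModule
    (fun c f g => by
      ext x
      simp only [mul_apply, smul_apply]
      rw [mul_finsum]
      exact finsum_congr fun q => mul_assoc _ _ _)
    (fun c f g => by
      ext x
      simp only [mul_apply, smul_apply]
      rw [mul_finsum]
      exact finsum_congr fun q => mul_left_comm _ _ _)

noncomputable instance [IsHeckePair H] : StarRing (HeckeAlgebra H) where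
  star_involutive f := by ext x; simp [star_apply]
  star_add f g := by ext x; simp [star_apply]
  star_mul f g := by
    ext x
    have hinv : ∀ h ∈ H, ∀ y, (star g) (x * (h * y)⁻¹) * (star f) (h * y) =
        (star g) (x * y⁻¹) * (star f) y := summand_inv (star g) (star f) x
    rw [mul_apply (star g), ← finsum_translate
      (F := fun y => (star g) (x * y⁻¹) * (star f) y) hinv x, star_apply, mul_apply]
    have hs : star (∑ᶠ q : RightCosets H, f (x⁻¹ * q.out⁻¹) * g q.out) =
        ∑ᶠ q : RightCosets H, star (f (x⁻¹ * q.out⁻¹) * g q.out) :=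
      (starAddEquiv : ℂ ≃+ ℂ).toAddMonoidHom.map_finsum
        (support_finite (fun y => f (x⁻¹ * y⁻¹)) g)
    rw [hs]
    refine finsum_congr fun q => ?_
    simp [star_apply, mul_comm]

instance [IsHeckePair H] : StarModule ℂ (HeckeAlgebra H) where
  star_smul c f := by ext x; simp [star_apply]

end HeckeAlgebra

end HeckeAlgebra

/-! ### Semigroup crossed products and enveloping C*-algebras -/

/-- A covariant representation of the action `α` of the semigroup `S` by (not necessarily unital)
*-endomorphisms of the unital *-algebra `A`: a unital representation `π` of `A` and a
representation `V` of `S` by isometries with `π (α_s a) = V_s π(a) V_s^*`. -/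
structure IsCovariantRep {S A B : Type*} [Monoid S]
    [Ring A] [StarRing A] [Algebra ℂ A] [Ring B] [StarRing B] [Algebra ℂ B]
    (α : S →* (A →⋆ₙₐ[ℂ] A)) (π : A →⋆ₐ[ℂ] B) (V : S →* B) : Prop where
  isometry : ∀ s, star (V s) * V s = 1
  covariant : ∀ s a, π (α s a) = V s * π a * star (V s)

/-- The *-algebra `B` with `(π, V)` is the *-algebraic semigroup crossed product `A ⋊_α S`: it is
generated by a covariant representation through which every covariant representation factors. -/
structure IsStarCrossedProduct.{t, w, x, y} {S : Type w} {A : Type x} {B : Type y} [Monoid S]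
    [Ring A] [StarRing A] [Algebra ℂ A]
    [Ring B] [StarRing B] [Algebra ℂ B] [StarModule ℂ B]
    (α : S →* (A →⋆ₙₐ[ℂ] A)) (π : A →⋆ₐ[ℂ] B) (V : S →* B) : Prop where
  covariantRep : IsCovariantRep α π V
  generates : StarAlgebra.adjoin ℂ (Set.range π ∪ Set.range V) = ⊤
  universal : ∀ (D : Type t) [Ring D] [StarRing D] [Algebra ℂ D] [StarModule ℂ D]
    (ρ : A →⋆ₐ[ℂ] D) (W : S →* D), IsCovariantRep α ρ W →
    ∃ φ : B →⋆ₐ[ℂ] D, (∀ a, φ (π a) = ρ a) ∧ ∀ s, φ (V s) = W s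

/-- The C*-algebra `B` with `(π, V)` is the C*-algebraic semigroup crossed product `A ⋊_α S`: it is
generated as a C*-algebra by a covariant representation through which every covariant
representation in a C*-algebra (for instance, of bounded operators on a Hilbert space) factors. -/
structure IsCStarCrossedProduct.{t, w, x, y} {S : Type w} {A : Type x} {B : Type y} [Monoid S]
    [CStarAlgebra A] [CStarAlgebra B]
    (α : S →* (A →⋆ₙₐ[ℂ] A)) (π : A →⋆ₐ[ℂ] B) (V : S →* B) : Prop where
  covariantRep : IsCovariantRep α π V
  generates : (StarAlgebra.adjoin ℂ (Set.range π ∪ Set.range V)).topologicalClosure = ⊤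
  universal : ∀ (D : Type t) [CStarAlgebra D]
    (ρ : A →⋆ₐ[ℂ] D) (W : S →* D), IsCovariantRep α ρ W →
    ∃ φ : B →⋆ₐ[ℂ] D, (∀ a, φ (π a) = ρ a) ∧ ∀ s, φ (V s) = W s

/-- The C*-algebra `C` with `ι : A → C` is the universal enveloping C*-algebra of the unital
*-algebra `A`: `ι` has dense range and every representation of `A` in a C*-algebra (for instance,
of bounded operators on a Hilbert space) factors through `ι`. -/
structure IsEnvelopingCStarAlgebra.{t, x, y} {A : Type x} {C : Type y}
    [Ring A] [StarRing A] [Algebra ℂ A] [CStarAlgebra C] (ι : A →⋆ₐ[ℂ] C) : Prop where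
  denseRange : DenseRange ι
  universal : ∀ (D : Type t) [CStarAlgebra D] (ρ : A →⋆ₐ[ℂ] D),
    ∃ φ : C →⋆ₐ[ℂ] D, ∀ a, φ (ι a) = ρ a

/-! ### The groups -/

section Groups

variable (K : Type*) [Field K]

/-- The action of `Kˣ` on the additive group `K` for which `x` acts as multiplication by `x⁻¹`. -/
def affineAction : Kˣ →* MulAut (Multiplicative K) where
  toFun x := AddEquiv.toMultiplicative (DistribMulAction.toAddEquiv K x⁻¹)
  map_one' := by ext; simp
  map_mul' x y := by ext a; simp [mul_smul, mul_comm]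

/-- The group `K ⋊ Kˣ`; the pair `(y, x)` corresponds to the matrix `(1, y x; 0, x)`, see
`AffineGroup.toMatrix`. -/
abbrev AffineGroup := Multiplicative K ⋊[affineAction K] Kˣ

variable {K}

theorem affineAction_apply (x : Kˣ) (y : Multiplicative K) :
    affineAction K x y = Multiplicative.ofAdd ((x⁻¹ : Kˣ) * y.toAdd) := rfl

/-- The embedding of `K ⋊ Kˣ` as the group of all matrices `(1, b; 0, x)` with `b` in `K` and `x`
in `Kˣ`. It carries `integralSubgroup` and `unitSubgroup` to the matrices with `x` a unit of `𝓞 K`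
and, respectively, `b` in `𝓞 K` or `b` arbitrary. -/
def AffineGroup.toMatrix : AffineGroup K →* Matrix (Fin 2) (Fin 2) K where
  toFun γ := !![1, γ.left.toAdd * γ.right; 0, γ.right]
  map_one' := by
    ext i j
    fin_cases i <;> fin_cases j <;> simp
  map_mul' γ δ := by
    ext i j
    fin_cases i <;> fin_cases j <;>
      simp [Matrix.mul_apply, Fin.sum_univ_two, affineAction_apply]
    field_simp
    ring

/-- The element `(0, a)` of `K ⋊ Kˣ`, i.e. the matrix `(1, 0; 0, a)`, for a nonzero algebraic
integer `a`. -/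
noncomputable def scaling [NumberField K] (a : (𝓞 K)⁰) : AffineGroup K :=
  SemidirectProduct.inr (Units.mk0 ((a : 𝓞 K) : K) (by
    simp))

variable (K) in
/-- The subgroup `(𝓞 K)ˣ` of `Kˣ`. -/
def integralUnits : Subgroup Kˣ := (Units.map (algebraMap (𝓞 K) K).toMonoidHom).range

variable (K) in
/-- The normal subgroup `K ⋊ (𝓞 K)ˣ` of `K ⋊ Kˣ`. -/
def unitSubgroup : Subgroup (AffineGroup K) :=
  (integralUnits K).comap SemidirectProduct.rightHom

instance : (unitSubgroup K).Normal := Subgroup.normal_comap _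

variable (K) in
/-- The subgroup `𝓞 K ⋊ (𝓞 K)ˣ` of `K ⋊ Kˣ`. -/
def integralSubgroup : Subgroup (AffineGroup K) where
  carrier := {γ | (∃ b : 𝓞 K, (b : K) = γ.left.toAdd) ∧ γ.right ∈ integralUnits K}
  one_mem' := ⟨⟨0, by simp⟩, by simp⟩
  mul_mem' := by
    rintro γ δ ⟨⟨b, hb⟩, hγ⟩ ⟨⟨c, hc⟩, hδ⟩
    refine ⟨?_, by simpa using mul_mem hγ hδ⟩
    obtain ⟨u, hu⟩ := inv_mem hγ
    refine ⟨b + (u : 𝓞 K) * c, ?_⟩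
    simp [affineAction_apply, ← hu, hb, hc]
  inv_mem' := by
    rintro γ ⟨⟨b, hb⟩, hγ⟩
    refine ⟨?_, by simpa using inv_mem hγ⟩
    obtain ⟨u, hu⟩ := hγ
    refine ⟨-((u : 𝓞 K) * b), ?_⟩
    rw [SemidirectProduct.inv_left, affineAction_apply, inv_inv, ← hu]
    simp [hb]

variable (K) in
/-- The semigroup `(𝓞 K)^× / (𝓞 K)ˣ` of nonzero algebraic integers modulo units, that is, of
principal nonzero integral ideals. -/
abbrev PrincipalIntegralIdeals := Associates (𝓞 K)⁰

end Groups

/-! The algebra rests on one inclusion: for a nonzero integer `a` and `s = scaling a`, conjugation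
gives `s⁻¹ Γ₀ s ⊆ Γ₀`. Hence `Γ₀ s Γ₀ = s Γ₀`, left multiplication by `[s]` is translation by `s`,
`[s][t] = [st]`, and `[s]^*[s] = R(s)·1`. So the elements `R(s)^{-1/2}[s]` are isometries,
multiplicative in `a` and trivial on units (`single_mul_single`, `star_single_mul_single`,
`heckeR_mul`). The action `α` is conjugation by them; it preserves the functions supported on `N`
because `Γ/N` is commutative.

The quotient `Γ/N`, that is `Kˣ` modulo integral units, is the group of fractions of `S`. It grades
the Hecke algebra of `Γ`; the part of degree one is that of `N`, and restriction to `N` is the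
projection `E` onto it. If `f` has degree `d(a)⁻¹ d(b)`, then `μ_a f μ_b^*` has degree one and `f =
μ_a^* j(E(μ_a f μ_b^*)) μ_b`. A homomorphism extending a covariant pair `(ρ, W)` must therefore send
`f` to `W_a^* ρ(E(μ_a f μ_b^*)) W_b`. Covariance makes this independent of the fraction
(`component_eq`), and fractions with a common middle term make it multiplicative (`component_mul`);
this is the universal property (`exists_starAlgHom`).

An enveloping C*-algebra exists once every element is bounded uniformly over all C*-seminorms:
complete in their supremum. An element `y` of `N` lies in a subgroup `L ⊇ Γ₀` of bounded
denominators with `L/Γ₀` finite. The functions supported on `L` form a finite-dimensional algebra,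
so `[y]^*[y]` is self-adjoint and algebraic, hence bounded in terms of an annihilating polynomial
(`of_isIntegral`, `isCStarBounded_subgroupOf`). Adding the isometries, of seminorm at most one,
gives boundedness for `Γ` (`IsHeckeScaling.isCStarBounded`). The C*-statement then follows by
combining universal properties with density. -/

/-! ### C*-seminorms and their supremum -/

section CStarSeminorm

variable {A : Type*} [Ring A] [StarRing A] [Algebra ℂ A]

/-- A seminorm on a `*`-algebra that is submultiplicative and satisfies the C*-identity. -/
structure IsCStarSeminorm (p : Seminorm ℂ A) : Prop where
  mul_le : ∀ a b, p (a * b) ≤ p a * p b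
  star_mul_self : ∀ a, p (star a * a) = p a * p a

namespace IsCStarSeminorm

variable {p : Seminorm ℂ A}

theorem apply_le_apply_star (hp : IsCStarSeminorm p) (a : A) : p a ≤ p (star a) := by
  rcases (apply_nonneg p a).eq_or_lt with h | h
  · rw [← h]; exact apply_nonneg p _
  · exact le_of_mul_le_mul_right ((hp.star_mul_self a).symm.le.trans (hp.mul_le _ _)) h

theorem apply_star (hp : IsCStarSeminorm p) (a : A) : p (star a) = p a :=
  le_antisymm (by simpa using hp.apply_le_apply_star (star a)) (hp.apply_le_apply_star a)

/-- The C*-identity makes `p 1` idempotent, so it is `0` or `1`; the value `0` does occur, for the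
zero seminorm. -/
theorem apply_one_le (hp : IsCStarSeminorm p) : p 1 ≤ 1 := by
  have h := hp.star_mul_self 1
  simp only [star_one, mul_one] at h
  nlinarith [apply_nonneg p (1 : A)]

theorem apply_isometry_le (hp : IsCStarSeminorm p) {v : A} (hv : star v * v = 1) : p v ≤ 1 := by
  have h := hp.star_mul_self v
  rw [hv] at h
  nlinarith [hp.apply_one_le, apply_nonneg p v]

theorem apply_algebraMap_le (hp : IsCStarSeminorm p) (c : ℂ) : p (algebraMap ℂ A c) ≤ ‖c‖ := by
  rw [Algebra.algebraMap_eq_smul_one, map_smul_eq_mul]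
  exact mul_le_of_le_one_right (norm_nonneg c) hp.apply_one_le

theorem apply_pow_le (hp : IsCStarSeminorm p) (a : A) : ∀ n : ℕ, p (a ^ n) ≤ p a ^ n
  | 0 => by simpa using hp.apply_one_le
  | n + 1 => by
    rw [pow_succ, pow_succ]
    exact (hp.mul_le _ _).trans
      (mul_le_mul_of_nonneg_right (hp.apply_pow_le a n) (apply_nonneg p a))

theorem apply_pow_two_pow (hp : IsCStarSeminorm p) {a : A} (ha : IsSelfAdjoint a) (k : ℕ) :
    p (a ^ 2 ^ k) = p a ^ 2 ^ k := by
  induction k with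
  | zero => simp
  | succ k ih =>
    have h := hp.star_mul_self (a ^ 2 ^ k)
    rw [(ha.pow _).star_eq, ih, ← pow_add, ← pow_add, ← two_mul, ← pow_succ'] at h
    exact h

/-- The C*-identity settles exponents that are powers of two. A general `n` is padded up to `2 ^ n`,
and submultiplicativity lets the extra factor `p a ^ (2 ^ n - n)` be cancelled. -/
theorem apply_pow (hp : IsCStarSeminorm p) {a : A} (ha : IsSelfAdjoint a) {n : ℕ} (hn : n ≠ 0) :
    p (a ^ n) = p a ^ n := by
  refine le_antisymm (hp.apply_pow_le a n) ?_
  rcases (apply_nonneg p a).eq_or_lt with h | h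
  · rw [← h, zero_pow hn]; exact apply_nonneg p _
  have hlt : n < 2 ^ n := Nat.lt_two_pow_self
  refine le_of_mul_le_mul_right ?_ (pow_pos h (2 ^ n - n))
  calc p a ^ n * p a ^ (2 ^ n - n) = p (a ^ n * a ^ (2 ^ n - n)) := by
        rw [← pow_add, ← pow_add, Nat.add_sub_cancel' hlt.le, hp.apply_pow_two_pow ha]
    _ ≤ p (a ^ n) * p (a ^ (2 ^ n - n)) := hp.mul_le _ _
    _ ≤ p (a ^ n) * p a ^ (2 ^ n - n) :=
        mul_le_mul_of_nonneg_left (hp.apply_pow_le a _) (apply_nonneg p _)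

theorem comp {B : Type*} [Ring B] [StarRing B] [Algebra ℂ B] {q : Seminorm ℂ B}
    (hq : IsCStarSeminorm q) (φ : A →⋆ₙₐ[ℂ] B) :
    IsCStarSeminorm (q.comp (LinearMapClass.linearMap φ)) where
  mul_le a b := by
    simp only [Seminorm.comp_apply, LinearMap.coe_coe, map_mul]
    exact hq.mul_le _ _
  star_mul_self a := by
    simp only [Seminorm.comp_apply, LinearMap.coe_coe, map_mul, map_star]
    exact hq.star_mul_self _

end IsCStarSeminorm

theorem isCStarSeminorm_norm (D : Type*) [CStarAlgebra D] : IsCStarSeminorm (normSeminorm ℂ D) where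
  mul_le := norm_mul_le
  star_mul_self a := CStarRing.norm_star_mul_self (x := a)

/-- The elements on which the C*-seminorms are uniformly bounded. -/
def IsCStarBounded (a : A) : Prop :=
  ∃ C : ℝ, ∀ p : Seminorm ℂ A, IsCStarSeminorm p → p a ≤ C

namespace IsCStarBounded

protected theorem add {a b : A} (ha : IsCStarBounded a) (hb : IsCStarBounded b) : IsCStarBounded (a + b) := by
  obtain ⟨C, hC⟩ := ha
  obtain ⟨D, hD⟩ := hb
  exact ⟨C + D, fun p hp => (map_add_le_add p a b).trans (add_le_add (hC p hp) (hD p hp))⟩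

protected theorem mul {a b : A} (ha : IsCStarBounded a) (hb : IsCStarBounded b) : IsCStarBounded (a * b) := by
  obtain ⟨C, hC⟩ := ha
  obtain ⟨D, hD⟩ := hb
  exact ⟨C * D, fun p hp => (hp.mul_le a b).trans (mul_le_mul (hC p hp) (hD p hp)
    (apply_nonneg p b) ((apply_nonneg p a).trans (hC p hp)))⟩

protected theorem algebraMap (c : ℂ) : IsCStarBounded (algebraMap ℂ A c) :=
  ⟨‖c‖, fun _ hp => hp.apply_algebraMap_le c⟩

protected theorem zero : IsCStarBounded (0 : A) := ⟨0, fun p _ => by simp⟩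

protected theorem smul (c : ℂ) {a : A} (ha : IsCStarBounded a) : IsCStarBounded (c • a) := by
  rw [Algebra.smul_def]
  exact (IsCStarBounded.algebraMap c).mul ha

protected theorem star {a : A} (ha : IsCStarBounded a) : IsCStarBounded (star a) := by
  obtain ⟨C, hC⟩ := ha
  exact ⟨C, fun p hp => (hp.apply_star a).trans_le (hC p hp)⟩

theorem of_isometry {a : A} (ha : star a * a = 1) : IsCStarBounded a :=
  ⟨1, fun _ hp => hp.apply_isometry_le ha⟩

theorem of_star_mul_self {a : A} (ha : IsCStarBounded (star a * a)) : IsCStarBounded a := by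
  obtain ⟨C, hC⟩ := ha
  refine ⟨max C 1, fun p hp => ?_⟩
  have h := (hp.star_mul_self a).symm.trans_le (hC p hp)
  rcases le_total (p a) 1 with h1 | h1
  · exact h1.trans (le_max_right _ _)
  · exact (le_mul_of_one_le_left (apply_nonneg p a) h1).trans (h.trans (le_max_left _ _))

protected theorem map {B : Type*} [Ring B] [StarRing B] [Algebra ℂ B] (φ : A →⋆ₙₐ[ℂ] B) {a : A}
    (ha : IsCStarBounded a) : IsCStarBounded (φ a) := by
  obtain ⟨C, hC⟩ := ha
  exact ⟨C, fun p hp => hC _ (hp.comp φ)⟩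

/-- A self-adjoint element that is algebraic over `ℂ` is bounded in C*-seminorms, by a bound for the
roots of an annihilating polynomial. -/
theorem of_isIntegral {a : A} (ha : IsSelfAdjoint a) (hint : IsIntegral ℂ a) :
    IsCStarBounded a := by
  obtain ⟨P, hmonic, hP⟩ := hint
  set n := P.natDegree with hn
  set M : ℝ := ∑ i ∈ Finset.range n, ‖P.coeff i‖ with hM
  have hM0 : 0 ≤ M := Finset.sum_nonneg fun _ _ => norm_nonneg _
  refine ⟨max 1 M, fun p hp => ?_⟩
  by_contra! hlt
  have h1 : 1 < p a := (le_max_left _ _).trans_lt hlt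
  have h2 : M < p a := (le_max_right _ _).trans_lt hlt
  rw [Polynomial.eval₂_eq_sum_range, Finset.sum_range_succ, ← hn, hmonic.coeff_natDegree, map_one,
    one_mul] at hP
  have hpow : a ^ n = -∑ i ∈ Finset.range n, algebraMap ℂ A (P.coeff i) * a ^ i :=
    eq_neg_of_add_eq_zero_right hP
  have hle : p (a ^ n) ≤ ∑ i ∈ Finset.range n, ‖P.coeff i‖ * p a ^ i := by
    rw [hpow, map_neg_eq_map]
    refine (Finset.le_sum_of_subadditive p (map_zero p).le (map_add_le_add p) _ _).trans
      (Finset.sum_le_sum fun i _ => ?_)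
    rw [← Algebra.smul_def, map_smul_eq_mul]
    exact mul_le_mul_of_nonneg_left (hp.apply_pow_le a i) (norm_nonneg _)
  -- A monic polynomial of degree zero that annihilates `a` forces `1 = 0` in `A`.
  rcases Nat.eq_zero_or_pos n with h0 | h0
  · have h10 : (1 : A) = 0 := by simpa [h0] using hpow
    have : a = 0 := by rw [← mul_one a, h10, mul_zero]
    rw [this, map_zero] at h1
    linarith
  rw [hp.apply_pow ha h0.ne'] at hle
  -- Since `p a > 1`, every lower power is at most `p a ^ (n - 1)`; cancelling this power gives `p a
  -- ≤ M`, a contradiction.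
  have hle' : p a ^ n ≤ M * p a ^ (n - 1) := by
    rw [hM, Finset.sum_mul]
    refine hle.trans (Finset.sum_le_sum fun i hi => ?_)
    refine mul_le_mul_of_nonneg_left (pow_le_pow_right₀ h1.le ?_) (norm_nonneg _)
    have := Finset.mem_range.1 hi
    omega
  obtain ⟨m, hm⟩ : ∃ m, n = m + 1 := ⟨n - 1, by omega⟩
  rw [hm, pow_succ', Nat.add_sub_cancel] at hle'
  exact absurd (le_of_mul_le_mul_right hle' (pow_pos (zero_lt_one.trans h1) m)) h2.not_ge

theorem of_mem_adjoin [StarModule ℂ A] {s : Set A} (hs : ∀ a ∈ s, IsCStarBounded a) {a : A}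
    (ha : a ∈ StarAlgebra.adjoin ℂ s) : IsCStarBounded a := by
  induction ha using StarAlgebra.adjoin_induction with
  | mem x hx => exact hs x hx
  | algebraMap c => exact .algebraMap c
  | add x y _ _ hx hy => exact hx.add hy
  | mul x y _ _ hx hy => exact hx.mul hy
  | star x _ hx => exact hx.star

end IsCStarBounded

variable (A) in
/-- The supremum of all C*-seminorms. -/
noncomputable def maxCStarSeminorm : Seminorm ℂ A :=
  ⨆ p : {p : Seminorm ℂ A // IsCStarSeminorm p}, p.1

theorem bddAbove_cStarSeminorm (hA : ∀ a : A, IsCStarBounded a) :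
    BddAbove (Set.range fun p : {p : Seminorm ℂ A // IsCStarSeminorm p} => p.1) := by
  refine Seminorm.bddAbove_range_iff.2 fun a => ?_
  obtain ⟨C, hC⟩ := hA a
  exact ⟨C, by rintro _ ⟨p, rfl⟩; exact hC p.1 p.2⟩

theorem le_maxCStarSeminorm (hA : ∀ a : A, IsCStarBounded a) {p : Seminorm ℂ A}
    (hp : IsCStarSeminorm p) : p ≤ maxCStarSeminorm A :=
  le_ciSup (bddAbove_cStarSeminorm hA) (⟨p, hp⟩ : {p : Seminorm ℂ A // IsCStarSeminorm p})

instance : Nonempty {p : Seminorm ℂ A // IsCStarSeminorm p} :=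
  ⟨⟨0, ⟨fun _ _ => by simp, fun _ => by simp⟩⟩⟩

theorem maxCStarSeminorm_le (hA : ∀ a : A, IsCStarBounded a) {a : A} {C : ℝ}
    (h : ∀ p : Seminorm ℂ A, IsCStarSeminorm p → p a ≤ C) : maxCStarSeminorm A a ≤ C := by
  rw [maxCStarSeminorm, Seminorm.iSup_apply (bddAbove_cStarSeminorm hA)]
  exact ciSup_le fun p => h p.1 p.2

/-- Each defining inequality passes to the supremum. For the lower bound in the C*-identity, `p a`
is bounded by the square root of the maximal seminorm of `star a * a`, a bound independent of `p`.
-/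
theorem isCStarSeminorm_maxCStarSeminorm (hA : ∀ a : A, IsCStarBounded a) :
    IsCStarSeminorm (maxCStarSeminorm A) := by
  have mul_le : ∀ a b : A,
      maxCStarSeminorm A (a * b) ≤ maxCStarSeminorm A a * maxCStarSeminorm A b := fun a b =>
    maxCStarSeminorm_le hA fun p hp => (hp.mul_le a b).trans
      (mul_le_mul (le_maxCStarSeminorm hA hp a) (le_maxCStarSeminorm hA hp b) (apply_nonneg _ _)
        (apply_nonneg _ _))
  have star_le : ∀ a : A, maxCStarSeminorm A (star a) ≤ maxCStarSeminorm A a := fun a =>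
    maxCStarSeminorm_le hA fun p hp => (hp.apply_star a).trans_le (le_maxCStarSeminorm hA hp a)
  refine ⟨mul_le, fun a => le_antisymm ((mul_le _ _).trans
    (mul_le_mul_of_nonneg_right (star_le a) (apply_nonneg _ _))) ?_⟩
  rw [← sq, ← Real.le_sqrt (apply_nonneg _ _) (apply_nonneg _ _)]
  refine maxCStarSeminorm_le hA fun p hp => ?_
  rw [Real.le_sqrt (apply_nonneg _ _) (apply_nonneg _ _), sq, ← hp.star_mul_self]
  exact le_maxCStarSeminorm hA hp _

end CStarSeminorm

/-! ### Completion of a `*`-algebra in a C*-seminorm -/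

section Completion

open UniformSpace

variable (A : Type*) [SeminormedRing A] [StarRing A]

theorem continuous_completion_map_star : Continuous (Completion.map (star : A → A)) :=
  Completion.continuous_map

variable [NormedStarGroup A]

theorem completion_map_star_coe (a : A) :
    Completion.map star (a : Completion A) = ((star a : A) : Completion A) :=
  Completion.map_coe (starNormedAddGroupHom (E := A)).uniformContinuous a

/-- The involution on the completion of a normed `*`-ring. -/
noncomputable abbrev completionStarRing : StarRing (Completion A) where
  star := Completion.map star
  star_involutive x := by
    have hc := continuous_completion_map_star A
    induction x using Completion.induction_on with
    | hp => exact isClosed_eq (hc.comp hc) continuous_id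
    | ih a => simp only [completion_map_star_coe, star_star]
  star_mul x y := by
    have hc := continuous_completion_map_star A
    induction x, y using Completion.induction_on₂ with
    | hp =>
      exact isClosed_eq (hc.comp continuous_mul)
        ((hc.comp continuous_snd).mul (hc.comp continuous_fst))
    | ih a b => simp only [← Completion.coe_mul, completion_map_star_coe, star_mul]
  star_add x y := by
    have hc := continuous_completion_map_star A
    induction x, y using Completion.induction_on₂ with
    | hp =>
      exact isClosed_eq (hc.comp continuous_add)
        ((hc.comp continuous_fst).add (hc.comp continuous_snd))
    | ih a b => simp only [← Completion.coe_add, completion_map_star_coe, star_add]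

attribute [local instance] completionStarRing

theorem completion_star_coe (a : A) : star (a : Completion A) = ((star a : A) : Completion A) :=
  completion_map_star_coe A a

theorem continuous_completion_star : Continuous (star : Completion A → Completion A) :=
  continuous_completion_map_star A

variable {A} in
theorem completion_norm_mul_self_le (h : ∀ a : A, ‖star a * a‖ = ‖a‖ * ‖a‖) (x : Completion A) :
    ‖x‖ * ‖x‖ ≤ ‖star x * x‖ := by
  have hc := continuous_completion_star A
  induction x using Completion.induction_on with
  | hp => exact isClosed_le (continuous_norm.mul continuous_norm) (hc.mul continuous_id).norm
  | ih a =>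
    rw [completion_star_coe, ← Completion.coe_mul, Completion.norm_coe, Completion.norm_coe, h]

variable {A} in
theorem completion_star_smul [NormedAlgebra ℂ A] [StarModule ℂ A] (c : ℂ) (x : Completion A) :
    star (c • x) = star c • star x := by
  have hc := continuous_completion_star A
  induction x using Completion.induction_on with
  | hp => exact isClosed_eq (hc.comp (continuous_const_smul c)) (continuous_const_smul (star c) |>.comp hc)
  | ih a => rw [← Completion.coe_smul, completion_star_coe, completion_star_coe, star_smul,
      Completion.coe_smul]

variable {A} in
/-- The completion of a `*`-algebra in a C*-seminorm. -/
noncomputable abbrev cStarAlgebraCompletion [NormedAlgebra ℂ A] [StarModule ℂ A]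
    (h : ∀ a : A, ‖star a * a‖ = ‖a‖ * ‖a‖) : CStarAlgebra (Completion A) :=
  { (inferInstance : NormedRing (Completion A)),
    (inferInstance : Algebra ℂ (Completion A)),
    (inferInstance : CompleteSpace (Completion A)),
    completionStarRing A with
    norm_smul_le := norm_smul_le
    star_smul := completion_star_smul
    norm_mul_self_le := completion_norm_mul_self_le h }

theorem IsCStarSeminorm.exists_completion {A : Type u} [Ring A] [StarRing A] [Algebra ℂ A]
    [StarModule ℂ A] {p : Seminorm ℂ A} (hp : IsCStarSeminorm p) :
    ∃ (C : Type u) (_ : CStarAlgebra C) (ι : A →⋆ₐ[ℂ] C), DenseRange ι ∧ ∀ a, ‖ι a‖ = p a := by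
  let : SeminormedRing A :=
    { p.toAddGroupSeminorm.toSeminormedAddCommGroup, ‹Ring A› with
      norm_mul_le := hp.mul_le }
  let : NormedAlgebra ℂ A := { ‹Algebra ℂ A› with norm_smul_le := fun c a => (map_smul_eq_mul p c a).le }
  have : NormedStarGroup A := ⟨fun a => (hp.apply_star a).le⟩
  let : CStarAlgebra (Completion A) := cStarAlgebraCompletion hp.star_mul_self
  -- The seminorm may have a kernel; no quotient is taken first, because the Hausdorff completion
  -- already collapses it.
  refine ⟨Completion A, inferInstance,
    { toFun := fun a => (a : Completion A)
      map_one' := Completion.coe_one A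
      map_mul' := Completion.coe_mul
      map_zero' := Completion.coe_zero
      map_add' := Completion.coe_add
      commutes' := fun _ => rfl
      map_star' := fun a => (Completion.map_coe (starNormedAddGroupHom (E := A)).uniformContinuous a).symm },
    Completion.denseRange_coe, Completion.norm_coe⟩

/-- Domination of all C*-seminorms is recorded instead of the universal property: it applies to
targets in any universe and also to non-unital homomorphisms, as needed for extending the action. -/
theorem exists_completion_maxCStarSeminorm {A : Type u} [Ring A] [StarRing A] [Algebra ℂ A]
    [StarModule ℂ A] (hA : ∀ a : A, IsCStarBounded a) :
    ∃ (C : Type u) (_ : CStarAlgebra C) (ι : A →⋆ₐ[ℂ] C), DenseRange ι ∧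
      ∀ p : Seminorm ℂ A, IsCStarSeminorm p → ∀ a, p a ≤ ‖ι a‖ := by
  obtain ⟨C, _, ι, hd, hn⟩ := (isCStarSeminorm_maxCStarSeminorm hA).exists_completion
  exact ⟨C, inferInstance, ι, hd, fun p hp a => (le_maxCStarSeminorm hA hp a).trans_eq (hn a).symm⟩

end Completion

/-! ### Extension of homomorphisms to the completion -/

section Extension

variable {A C D : Type*} [Ring A] [StarRing A] [Algebra ℂ A] [CStarAlgebra C] [CStarAlgebra D]

/-- The norm pulled back along `ρ` is a C*-seminorm, whether or not `ρ` is unital. It is thus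
dominated by the norm of `ι`, so `ρ` extends by continuity. -/
theorem exists_nonUnitalStarAlgHom_extension {ι : A →⋆ₐ[ℂ] C} (hd : DenseRange ι)
    (hp : ∀ p : Seminorm ℂ A, IsCStarSeminorm p → ∀ a, p a ≤ ‖ι a‖) (ρ : A →⋆ₙₐ[ℂ] D) :
    ∃ φ : C →⋆ₙₐ[ℂ] D, ∀ a, φ (ι a) = ρ a := by
  have hle : ∀ a, ‖ρ a‖ ≤ 1 * ‖ι a‖ := fun a => by
    rw [one_mul]
    exact hp _ ((isCStarSeminorm_norm D).comp ρ) a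
  let Φ : C →L[ℂ] D :=
    (LinearMapClass.linearMap ρ : A →ₗ[ℂ] D).extendOfNorm (LinearMapClass.linearMap ι : A →ₗ[ℂ] C)
  have hΦ : ∀ a, Φ (ι a) = ρ a := fun a =>
    LinearMap.extendOfNorm_eq (f := (LinearMapClass.linearMap ρ : A →ₗ[ℂ] D))
      (e := (LinearMapClass.linearMap ι : A →ₗ[ℂ] C)) hd ⟨1, hle⟩ a
  refine ⟨{ Φ with
    map_mul' := fun x y => ?_
    map_zero' := Φ.map_zero
    map_smul' := fun c x => Φ.map_smul c x
    map_star' := fun x => ?_ }, hΦ⟩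
  · change Φ (x * y) = Φ x * Φ y
    refine hd.induction_on₂ (p := fun x y => Φ (x * y) = Φ x * Φ y)
      (isClosed_eq (by fun_prop) (by fun_prop)) (fun a b => ?_) x y
    rw [← map_mul, hΦ, hΦ, hΦ, map_mul]
  · change Φ (star x) = star (Φ x)
    refine hd.induction_on (p := fun x => Φ (star x) = star (Φ x)) x
      (isClosed_eq (by fun_prop) (by fun_prop)) (fun a => ?_)
    rw [← map_star, hΦ, hΦ, map_star]

theorem exists_starAlgHom_extension {ι : A →⋆ₐ[ℂ] C} (hd : DenseRange ι)
    (hp : ∀ p : Seminorm ℂ A, IsCStarSeminorm p → ∀ a, p a ≤ ‖ι a‖) (ρ : A →⋆ₐ[ℂ] D) :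
    ∃ φ : C →⋆ₐ[ℂ] D, ∀ a, φ (ι a) = ρ a := by
  obtain ⟨φ, hφ⟩ := exists_nonUnitalStarAlgHom_extension hd hp (ρ : A →⋆ₙₐ[ℂ] D)
  have h1 : φ 1 = 1 := by
    have := hφ 1
    rw [map_one] at this
    simpa using this
  exact ⟨{ φ with
    map_one' := h1
    commutes' := fun c => by
      change φ (algebraMap ℂ C c) = algebraMap ℂ D c
      rw [Algebra.algebraMap_eq_smul_one, Algebra.algebraMap_eq_smul_one, map_smul, h1] }, hφ⟩

theorem isEnvelopingCStarAlgebra_of_cStarSeminorm_le.{t} {ι : A →⋆ₐ[ℂ] C} (hd : DenseRange ι)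
    (hp : ∀ p : Seminorm ℂ A, IsCStarSeminorm p → ∀ a, p a ≤ ‖ι a‖) :
    IsEnvelopingCStarAlgebra.{t} ι :=
  ⟨hd, fun _ _ ρ => exists_starAlgHom_extension hd hp ρ⟩

theorem continuous_nonUnitalStarAlgHom (φ : C →⋆ₙₐ[ℂ] D) : Continuous φ :=
  AddMonoidHomClass.continuous_of_bound φ 1 fun x => by
    simpa only [one_mul] using NonUnitalStarAlgHom.norm_apply_le φ x

theorem nonUnitalStarAlgHom_eq_of_denseRange {ι : A →⋆ₐ[ℂ] C} (hd : DenseRange ι)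
    {φ ψ : C →⋆ₙₐ[ℂ] D} (h : ∀ a, φ (ι a) = ψ (ι a)) : φ = ψ := by
  ext x
  exact hd.induction_on (p := fun x => φ x = ψ x) x
    (isClosed_eq (continuous_nonUnitalStarAlgHom φ) (continuous_nonUnitalStarAlgHom ψ)) h

end Extension

/-! ### From the algebraic to the C*-algebraic crossed product -/

section CrossedProduct

variable {S A B : Type*} [Monoid S] [Ring A] [StarRing A] [Algebra ℂ A]
  [Ring B] [StarRing B] [Algebra ℂ B] [StarModule ℂ B]

/-- The enveloping C*-algebra of a `*`-algebraic semigroup crossed product is the C*-algebraic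
crossed product of the enveloping C*-algebra. -/
theorem IsStarCrossedProduct.isCStarCrossedProduct.{t} {α : S →* (A →⋆ₙₐ[ℂ] A)} {j : A →⋆ₐ[ℂ] B}
    {μ : S →* B} (h : IsStarCrossedProduct.{t} α j μ) {CA CB : Type*} [CStarAlgebra CA]
    [CStarAlgebra CB] {ιA : A →⋆ₐ[ℂ] CA} {ιB : B →⋆ₐ[ℂ] CB} (hA : DenseRange ιA)
    (hB : IsEnvelopingCStarAlgebra.{t} ιB) {β : S →* (CA →⋆ₙₐ[ℂ] CA)} {i : CA →⋆ₐ[ℂ] CB}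
    (hβ : ∀ s a, β s (ιA a) = ιA (α s a)) (hi : ∀ a, i (ιA a) = ιB (j a)) :
    IsCStarCrossedProduct.{t} β i ((ιB : B →* CB).comp μ) := by
  have hicont : Continuous i := continuous_nonUnitalStarAlgHom (i : CA →⋆ₙₐ[ℂ] CB)
  refine ⟨⟨fun s => ?_, fun s c => ?_⟩, ?_, ?_⟩
  · change star (ιB (μ s)) * ιB (μ s) = 1
    rw [← map_star, ← map_mul, h.covariantRep.isometry, map_one]
  · change i (β s c) = ιB (μ s) * i c * star (ιB (μ s))
    have hβcont : Continuous (β s) := continuous_nonUnitalStarAlgHom (β s)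
    refine hA.induction_on (p := fun c => i (β s c) = ιB (μ s) * i c * star (ιB (μ s))) c
      (isClosed_eq (by fun_prop) (by fun_prop)) fun a => ?_
    rw [hβ, hi, hi, h.covariantRep.covariant, map_mul, map_mul, map_star]
  · have hle : (⊤ : StarSubalgebra ℂ B) ≤ (StarAlgebra.adjoin ℂ
        (Set.range i ∪ Set.range ((ιB : B →* CB).comp μ))).comap ιB := by
      rw [← h.generates, StarAlgebra.adjoin_le_iff]
      rintro _ (⟨a, rfl⟩ | ⟨s, rfl⟩)
      · exact StarAlgebra.subset_adjoin ℂ _ (Or.inl ⟨ιA a, hi a⟩)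
      · exact StarAlgebra.subset_adjoin ℂ _ (Or.inr ⟨s, rfl⟩)
    refine top_unique fun c _ => ?_
    have hsub : Set.range ιB ⊆ (StarAlgebra.adjoin ℂ
        (Set.range i ∪ Set.range ((ιB : B →* CB).comp μ)) : Set CB) :=
      Set.range_subset_iff.2 fun b => hle (show b ∈ ⊤ from trivial)
    exact closure_mono hsub (hB.denseRange c)
  · intro D _ ρ W hW
    -- A covariant pair for `CA` restricts along `ιA` to one for `A`. It factors through `B`, and
    -- then through the envelope of `B`; agreement with `ρ` on all of `CA` follows by density.
    obtain ⟨φ, hφj, hφμ⟩ := h.universal D (ρ.comp ιA) W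
      ⟨hW.isometry, fun s a => by
        rw [StarAlgHom.comp_apply, StarAlgHom.comp_apply, ← hβ, hW.covariant]⟩
    obtain ⟨ψ, hψ⟩ := hB.universal D φ
    refine ⟨ψ, fun c => ?_, fun s => (hψ _).trans (hφμ s)⟩
    have hψcont : Continuous ψ := continuous_nonUnitalStarAlgHom (ψ : CB →⋆ₙₐ[ℂ] D)
    have hρcont : Continuous ρ := continuous_nonUnitalStarAlgHom (ρ : CA →⋆ₙₐ[ℂ] D)
    refine hA.induction_on (p := fun c => ψ (i c) = ρ c) c
      (isClosed_eq (by fun_prop) (by fun_prop)) fun a => ?_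
    rw [hi, hψ, hφj, StarAlgHom.comp_apply]

end CrossedProduct

/-! ### Crossed products from gradings by a group of fractions -/

section Grading

variable {S Q A B : Type*} [CommMonoid S] [CommGroup Q] [Ring A] [StarRing A] [Algebra ℂ A]
  [Ring B] [StarRing B] [Algebra ℂ B]

/-- A grading of `B` by a group of fractions `Q` of the semigroup `S`, compatible with a covariant
representation `(j, μ)` in `B` for which `j` identifies `A` with the part of degree `1`, with a
conditional expectation `E` of `B` onto that part. -/
structure IsCovariantGrading (α : S →* (A →⋆ₙₐ[ℂ] A)) (j : A →⋆ₐ[ℂ] B) (μ : S →* B)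
    (𝓑 : Q → Submodule ℂ B) (d : S →* Q) (E : B →ₗ[ℂ] A) : Prop where
  covariantRep : IsCovariantRep α j μ
  mul_mem : ∀ {x y f g}, f ∈ 𝓑 x → g ∈ 𝓑 y → f * g ∈ 𝓑 (x * y)
  star_mem : ∀ {x f}, f ∈ 𝓑 x → star f ∈ 𝓑 x⁻¹
  iSup_eq_top : ⨆ x, 𝓑 x = ⊤
  injective : Function.Injective d
  exists_mul_eq : ∀ x, ∃ a b, d a * x = d b
  isometry_mem : ∀ s, μ s ∈ 𝓑 (d s)
  map_mem : ∀ a, j a ∈ 𝓑 1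
  map_expectation : ∀ {f}, f ∈ 𝓑 1 → j (E f) = f
  expectation_of_ne : ∀ {x f}, x ≠ 1 → f ∈ 𝓑 x → E f = 0
  expectation_map : ∀ a, E (j a) = a

namespace IsCovariantGrading

/-- The map `f ↦ E (μ_a f μ_b^*)`. -/
def compress {S A B : Type*} [Monoid S] [Ring A] [Algebra ℂ A] [Ring B] [StarRing B] [Algebra ℂ B]
    (μ : S →* B) (E : B →ₗ[ℂ] A) (a b : S) : B →ₗ[ℂ] A :=
  E ∘ₗ LinearMap.mulRight ℂ (star (μ b)) ∘ₗ LinearMap.mulLeft ℂ (μ a)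

theorem compress_apply {S A B : Type*} [Monoid S] [Ring A] [Algebra ℂ A] [Ring B] [StarRing B]
    [Algebra ℂ B] (μ : S →* B) (E : B →ₗ[ℂ] A) (a b : S) (f : B) : compress μ E a b f = E (μ a * f * star (μ b)) := rfl

variable {α : S →* (A →⋆ₙₐ[ℂ] A)} {j : A →⋆ₐ[ℂ] B} {μ : S →* B} {𝓑 : Q → Submodule ℂ B}
  {d : S →* Q} {E : B →ₗ[ℂ] A}

variable (h : IsCovariantGrading α j μ 𝓑 d E)
include h

theorem map_injective : Function.Injective j :=
  Function.LeftInverse.injective (g := E) h.expectation_map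

theorem compress_mem {x : Q} {f : B} (hf : f ∈ 𝓑 x) (a b : S) :
    μ a * f * star (μ b) ∈ 𝓑 (d a * x * (d b)⁻¹) :=
  h.mul_mem (h.mul_mem (h.isometry_mem a) hf) (h.star_mem (h.isometry_mem b))

theorem map_compress {x : Q} {f : B} (hf : f ∈ 𝓑 x) {a b : S} (hab : d a * x = d b) :
    j (compress μ E a b f) = μ a * f * star (μ b) := by
  refine h.map_expectation ?_
  have := h.compress_mem hf a b
  rwa [hab, mul_inv_cancel] at this

theorem compress_of_ne {x : Q} {f : B} (hf : f ∈ 𝓑 x) {a b : S} (hab : d a * x ≠ d b) :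
    compress μ E a b f = 0 :=
  h.expectation_of_ne (fun h1 => hab (mul_inv_eq_one.1 h1)) (h.compress_mem hf a b)

/-- Enlarging the fraction `(a, b)` by `c` conjugates by `μ c`, which is `α c` on the part of degree
one. -/
theorem compress_mul_mul {x : Q} {f : B} (hf : f ∈ 𝓑 x) {a b : S} (hab : d a * x = d b) (c : S) :
    compress μ E (c * a) (c * b) f = α c (compress μ E a b f) := by
  refine h.map_injective ?_
  rw [h.covariantRep.covariant, h.map_compress hf hab,
    h.map_compress hf (by rw [map_mul, map_mul, mul_assoc, hab])]
  simp only [map_mul, star_mul, mul_assoc]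

theorem compress_star {x : Q} {f : B} (hf : f ∈ 𝓑 x) {a b : S} (hab : d a * x = d b) :
    compress μ E b a (star f) = star (compress μ E a b f) := by
  refine h.map_injective ?_
  rw [map_star j, h.map_compress hf hab, h.map_compress (h.star_mem hf) (by rw [← hab]; group)]
  simp only [star_mul, star_star, mul_assoc]

theorem compress_mul {x y : Q} {f g : B} (hf : f ∈ 𝓑 x) (hg : g ∈ 𝓑 y) {a b c : S}
    (hab : d a * x = d b) (hbc : d b * y = d c) :
    compress μ E a b f * compress μ E b c g = compress μ E a c (f * g) := by
  refine h.map_injective ?_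
  rw [map_mul, h.map_compress hf hab, h.map_compress hg hbc,
    h.map_compress (h.mul_mem hf hg) (by rw [← mul_assoc, hab, hbc])]
  have := h.covariantRep.isometry b
  simp only [mul_assoc]
  rw [← mul_assoc (star (μ b)) (μ b), this, one_mul]

/-- The projection `μ b * star (μ b)` is the image of `α b 1` and is absorbed by the trailing `star
(μ b)`. Applying `ρ` lets `W b * star (W b)` be inserted in `component_mul`. -/
theorem compress_mul_map_one {x : Q} {f : B} (hf : f ∈ 𝓑 x) {a b : S} (hab : d a * x = d b) :
    compress μ E a b f * α b 1 = compress μ E a b f := by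
  refine h.map_injective ?_
  rw [map_mul, h.map_compress hf hab, h.covariantRep.covariant, map_one, mul_one]
  have := h.covariantRep.isometry b
  simp only [mul_assoc]
  rw [← mul_assoc (star (μ b)) (μ b), this, one_mul]

/-- This recovers a homogeneous element from its compression. It gives generation, and it dictates
the formula for the induced homomorphism. -/
theorem eq_compress {x : Q} {f : B} (hf : f ∈ 𝓑 x) {a b : S} (hab : d a * x = d b) :
    f = star (μ a) * j (compress μ E a b f) * μ b := by
  rw [h.map_compress hf hab]
  have h1 := h.covariantRep.isometry a
  have h2 := h.covariantRep.isometry b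
  simp only [mul_assoc]
  rw [h2, mul_one, ← mul_assoc, h1, one_mul]

theorem induction_homogeneous {p : B → Prop} (f : B) (mem : ∀ x, ∀ f ∈ 𝓑 x, p f)
    (zero : p 0) (add : ∀ f g, p f → p g → p (f + g)) : p f :=
  Submodule.iSup_induction 𝓑 (motive := p) (h.iSup_eq_top ▸ Submodule.mem_top : f ∈ ⨆ x, 𝓑 x) mem zero add

theorem adjoin_eq_top [StarModule ℂ B] : StarAlgebra.adjoin ℂ (Set.range j ∪ Set.range μ) = ⊤ := by
  refine top_unique fun f _ => ?_
  refine h.induction_homogeneous f (fun x f hf => ?_) (zero_mem _) fun _ _ => add_mem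
  obtain ⟨a, b, hab⟩ := h.exists_mul_eq x
  have hμ : ∀ s, μ s ∈ StarAlgebra.adjoin ℂ (Set.range j ∪ Set.range μ) := fun s =>
    StarAlgebra.subset_adjoin ℂ _ (Or.inr ⟨s, rfl⟩)
  rw [h.eq_compress hf hab]
  exact MulMemClass.mul_mem (MulMemClass.mul_mem (StarMemClass.star_mem (hμ a)) (StarAlgebra.subset_adjoin ℂ _ (Or.inl ⟨_, rfl⟩)))
    (hμ b)

omit h

variable {D : Type*} [Ring D] [StarRing D] [Algebra ℂ D]

/-- The map `f ↦ W_a^* ρ(E(μ_a f μ_b^*)) W_b`. -/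
def component (μ : S →* B) (E : B →ₗ[ℂ] A) (ρ : A →⋆ₐ[ℂ] D) (W : S →* D) (a b : S) : B →ₗ[ℂ] D :=
  LinearMap.mulRight ℂ (W b) ∘ₗ LinearMap.mulLeft ℂ (star (W a)) ∘ₗ
    (ρ : A →ₐ[ℂ] D).toLinearMap ∘ₗ compress μ E a b

variable {ρ : A →⋆ₐ[ℂ] D} {W : S →* D}

theorem component_apply (a b : S) (f : B) :
    component μ E ρ W a b f = star (W a) * ρ (compress μ E a b f) * W b := rfl

variable (hW : IsCovariantRep α ρ W)
include h

theorem component_of_ne {x : Q} {f : B} (hf : f ∈ 𝓑 x) {a b : S} (hab : d a * x ≠ d b) :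
    component μ E ρ W a b f = 0 := by
  rw [component_apply, h.compress_of_ne hf hab, map_zero, mul_zero, zero_mul]

theorem component_star {x : Q} {f : B} (hf : f ∈ 𝓑 x) {a b : S} (hab : d a * x = d b) :
    component μ E ρ W b a (star f) = star (component μ E ρ W a b f) := by
  rw [component_apply, component_apply, h.compress_star hf hab]
  simp only [star_mul, star_star, map_star, mul_assoc]

include hW

theorem component_mul_mul {x : Q} {f : B} (hf : f ∈ 𝓑 x) {a b : S} (hab : d a * x = d b) (c : S) :
    component μ E ρ W (c * a) (c * b) f = component μ E ρ W a b f := by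
  rw [component_apply, component_apply, h.compress_mul_mul hf hab, hW.covariant, map_mul, map_mul,
    star_mul]
  have := hW.isometry c
  simp only [mul_assoc]
  rw [← mul_assoc (star (W c)) (W c) (W b), this, ← mul_assoc (star (W c)) (W c), this, one_mul,
    one_mul]

/-- Two fractions for `x` are enlarged to the common numerator `a * a'`; injectivity of `d` then
makes the other terms agree. -/
theorem component_eq {x : Q} {f : B} (hf : f ∈ 𝓑 x) {a b a' b' : S} (hab : d a * x = d b)
    (hab' : d a' * x = d b') : component μ E ρ W a b f = component μ E ρ W a' b' f := by
  rw [← h.component_mul_mul hW hf hab a', ← h.component_mul_mul hW hf hab' a, mul_comm a' a]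
  have : a' * b = a * b' := h.injective (by rw [map_mul, map_mul, ← hab, ← hab', mul_left_comm])
  rw [this]

theorem component_mul {x y : Q} {f g : B} (hf : f ∈ 𝓑 x) (hg : g ∈ 𝓑 y) {a b c : S}
    (hab : d a * x = d b) (hbc : d b * y = d c) :
    component μ E ρ W a c (f * g) = component μ E ρ W a b f * component μ E ρ W b c g := by
  have h1 : W b * star (W b) = ρ (α b 1) := by rw [hW.covariant, map_one, mul_one]
  rw [component_apply, component_apply, component_apply, ← h.compress_mul hf hg hab hbc,
    map_mul]
  have h2 := congrArg ρ (h.compress_mul_map_one hf hab)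
  rw [map_mul, ← h1] at h2
  nth_rewrite 1 [← h2]
  simp only [mul_assoc]

/-- Choose one fraction per degree and sum the resulting components. Each component vanishes on the
other degrees because `E` does, so it extracts its own degree and no separate proof that the sum of
the `𝓑 x` is direct is needed. -/
theorem exists_linearMap : ∃ φ : B →ₗ[ℂ] D, ∀ (x : Q) (f : B), f ∈ 𝓑 x → ∀ a b, d a * x = d b →
    φ f = component μ E ρ W a b f := by
  choose n m hnm using h.exists_mul_eq
  have hne : ∀ {x y : Q} {f : B}, f ∈ 𝓑 x → y ≠ x → component μ E ρ W (n y) (m y) f = 0 :=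
    fun {x y f} hf hyx => h.component_of_ne hf fun hx => hyx (mul_left_cancel ((hnm y).trans hx.symm))
  have hfin : ∀ f : B, (Function.support fun x => component μ E ρ W (n x) (m x) f).Finite := by
    intro f
    refine h.induction_homogeneous
      (p := fun f => (Function.support fun x => component μ E ρ W (n x) (m x) f).Finite) f
      (fun x f hf => ?_) ?_ fun f g hf hg => ?_
    · exact (Set.finite_singleton x).subset fun y hy => by_contra fun hyx => hy (hne hf hyx)
    · simp
    · simp only [map_add]
      exact (hf.union hg).subset (Function.support_add _ _)
  refine ⟨
    { toFun := fun f => ∑ᶠ x, component μ E ρ W (n x) (m x) f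
      map_add' := fun f g => by
        simp only [map_add]
        exact finsum_add_distrib (hfin f) (hfin g)
      map_smul' := fun c f => by
        simp only [map_smul, RingHom.id_apply]
        exact (smul_finsum' c (hfin f)).symm }, fun x f hf a b hab => ?_⟩
  change ∑ᶠ y, component μ E ρ W (n y) (m y) f = _
  rw [finsum_eq_single _ x fun y hy => hne hf hy]
  exact h.component_eq hW hf (hnm x) hab

theorem exists_starAlgHom [StarModule ℂ D] :
    ∃ φ : B →⋆ₐ[ℂ] D, (∀ a, φ (j a) = ρ a) ∧ ∀ s, φ (μ s) = W s := by
  obtain ⟨φ, hφ⟩ := h.exists_linearMap hW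
  have hj : ∀ a, φ (j a) = ρ a := fun a => by
    rw [hφ 1 _ (h.map_mem a) 1 1 (mul_one _), component_apply, compress_apply]
    simp [h.expectation_map]
  have hμ : ∀ s, φ (μ s) = W s := fun s => by
    have h1 : E (μ s * star (μ s)) = α s 1 := by
      have := h.covariantRep.covariant s 1
      rw [map_one j, mul_one] at this
      rw [← this, h.expectation_map]
    rw [hφ _ _ (h.isometry_mem s) 1 s (by rw [map_one, one_mul]), component_apply, compress_apply]
    simp only [map_one, one_mul, star_one]
    rw [h1, hW.covariant, map_one, mul_one, mul_assoc, hW.isometry, mul_one]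
  have hone : φ 1 = 1 := by simpa using hj 1
  have hmul : ∀ f g, φ (f * g) = φ f * φ g := fun f g => by
    refine h.induction_homogeneous (p := fun f => φ (f * g) = φ f * φ g) f (fun x f hf => ?_)
      (by simp) fun f f' hf hf' => by simp only [add_mul, map_add, hf, hf']
    refine h.induction_homogeneous (p := fun g => φ (f * g) = φ f * φ g) g (fun y g hg => ?_)
      (by simp) fun g g' hg hg' => by simp only [mul_add, map_add, hg, hg']
    obtain ⟨a, b, hab⟩ := h.exists_mul_eq x
    obtain ⟨c, e, hce⟩ := h.exists_mul_eq y
    -- The fractions for `x` and `y` are enlarged by `c` and `b`, so that they share the middle term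
    -- `c * b` required by `component_mul`.
    have h1 : d (c * a) * x = d (c * b) := by rw [map_mul, map_mul, mul_assoc, hab]
    have h2 : d (c * b) * y = d (b * e) := by rw [mul_comm c b, map_mul, map_mul, mul_assoc, hce]
    rw [hφ x f hf _ _ h1, hφ y g hg _ _ h2,
      hφ (x * y) _ (h.mul_mem hf hg) (c * a) (b * e) (by rw [← mul_assoc, h1, h2])]
    exact h.component_mul hW hf hg h1 h2
  have hstar : ∀ f, φ (star f) = star (φ f) := fun f => by
    refine h.induction_homogeneous (p := fun f => φ (star f) = star (φ f)) f (fun x f hf => ?_)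
      (by simp) fun f f' hf hf' => by simp only [star_add, map_add, hf, hf']
    obtain ⟨a, b, hab⟩ := h.exists_mul_eq x
    rw [hφ x f hf a b hab, hφ x⁻¹ _ (h.star_mem hf) b a (by rw [← hab]; group)]
    exact h.component_star hf hab
  exact ⟨{ φ with
    map_one' := hone
    map_mul' := hmul
    map_zero' := map_zero φ
    commutes' := fun c => by
      change φ (algebraMap ℂ B c) = algebraMap ℂ D c
      rw [Algebra.algebraMap_eq_smul_one, Algebra.algebraMap_eq_smul_one, map_smul, hone]
    map_star' := hstar }, hj, hμ⟩

omit hW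

theorem isStarCrossedProduct.{t} [StarModule ℂ B] : IsStarCrossedProduct.{t} α j μ where
  covariantRep := h.covariantRep
  generates := h.adjoin_eq_top
  universal _ _ _ _ _ _ _ hW := h.exists_starAlgHom hW

end IsCovariantGrading

end Grading

/-! ### Hecke algebras: double cosets, supports and subgroups -/

namespace HeckeAlgebra

variable {G : Type*} [Group G] {H : Subgroup G}

section Single

theorem mem_doubleCoset_iff_mk_eq (γ x : G) :
    x ∈ DoubleCoset.doubleCoset γ (H : Set G) (H : Set G) ↔
      DoubleCoset.mk H H x = DoubleCoset.mk H H γ := by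
  rw [eq_comm, DoubleCoset.eq, DoubleCoset.mem_doubleCoset]
  rfl

theorem apply_eq_of_mk_eq (f : HeckeAlgebra H) {x y : G}
    (h : DoubleCoset.mk H H x = DoubleCoset.mk H H y) : f x = f y := by
  obtain ⟨h, hh, k, hk, rfl⟩ := (DoubleCoset.eq H H x y).1 h
  rw [f.right_inv hk, f.left_inv hh]

/-- Evaluation at an element of the group. -/
def evalₗ (x : G) : HeckeAlgebra H →ₗ[ℂ] ℂ where
  toFun f := f x
  map_add' _ _ := rfl
  map_smul' _ _ := rfl

theorem span_range_single : Submodule.span ℂ (Set.range (single H)) = ⊤ := by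
  refine top_unique fun f _ => ?_
  have hf : f = ∑ d ∈ f.finite_doubleCosets.toFinset, f d.out • single H d.out := by
    ext x
    change f x = evalₗ x _
    rw [map_sum]
    simp only [map_smul, smul_eq_mul]
    change f x = ∑ d ∈ f.finite_doubleCosets.toFinset, f d.out * single H d.out x
    classical
    have hmk : ∀ d : DoubleCoset.Quotient (H : Set G) H, single H d.out x =
        if DoubleCoset.mk H H x = d then 1 else 0 := fun d => by
      rw [single_apply, Set.indicator_apply, mem_doubleCoset_iff_mk_eq, DoubleCoset.out_eq']
      rfl
    simp only [hmk, mul_ite, mul_one, mul_zero]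
    rw [Finset.sum_ite_eq, apply_eq_of_mk_eq f (DoubleCoset.out_eq' H H (DoubleCoset.mk H H x))]
    split_ifs with hx
    · rfl
    · by_contra h0
      exact hx (f.finite_doubleCosets.mem_toFinset.2 ⟨x, h0, rfl⟩)
  rw [hf]
  exact Submodule.sum_mem _ fun d _ => Submodule.smul_mem _ _ (Submodule.subset_span ⟨_, rfl⟩)

variable {s t : G}

/-- Since `H s ⊆ s H`, the double coset is the single left coset `s H`. This is what makes
convolution with `single H s` explicit. -/
theorem mem_doubleCoset_iff_of_conj_mem (hs : ∀ h ∈ H, s⁻¹ * h * s ∈ H) (x : G) :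
    x ∈ DoubleCoset.doubleCoset s (H : Set G) (H : Set G) ↔ s⁻¹ * x ∈ H := by
  rw [DoubleCoset.mem_doubleCoset]
  constructor
  · rintro ⟨h, hh, k, hk, rfl⟩
    have := H.mul_mem (hs h hh) hk
    simpa [mul_assoc] using this
  · intro hx
    exact ⟨1, H.one_mem, _, hx, by group⟩

open Classical in
theorem single_apply_of_conj_mem (hs : ∀ h ∈ H, s⁻¹ * h * s ∈ H) (x : G) :
    single H s x = if s⁻¹ * x ∈ H then 1 else 0 := by
  rw [single_apply, Set.indicator_apply, mem_doubleCoset_iff_of_conj_mem hs]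
  rfl

theorem single_eq_one_of_mem [IsHeckePair H] (hs : s ∈ H) : single H s = 1 := by
  ext x
  classical
  rw [single_apply_of_conj_mem (fun h hh => H.mul_mem (H.mul_mem (H.inv_mem hs) hh) hs), one_apply,
    Set.indicator_apply, H.mul_mem_cancel_left (H.inv_mem hs)]
  rfl

variable [IsHeckePair H]

/-- Only the right coset of `s⁻¹ * γ` contributes to the convolution sum. -/
theorem single_mul_apply (hs : ∀ h ∈ H, s⁻¹ * h * s ∈ H) (f : HeckeAlgebra H) (γ : G) :
    (single H s * f) γ = f (s⁻¹ * γ) := by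
  classical
  rw [mul_apply, finsum_eq_single _ (toRightCoset H (s⁻¹ * γ))]
  · obtain ⟨h, hh, e⟩ := exists_out_toRightCoset (H := H) (s⁻¹ * γ)
    rw [e, f.left_inv hh, single_apply_of_conj_mem hs, if_pos, one_mul]
    simpa [mul_assoc] using hh
  · intro q hq
    rw [single_apply_of_conj_mem hs, if_neg, zero_mul]
    intro hmem
    refine hq ?_
    rw [← toRightCoset_out q]
    refine toRightCoset_eq_iff.2 ?_
    simpa [mul_assoc] using hmem

theorem mul_star_single_apply (hs : ∀ h ∈ H, s⁻¹ * h * s ∈ H) (f : HeckeAlgebra H) (γ : G) :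
    (f * star (single H s)) γ = f (γ * s) := by
  have h : f * star (single H s) = star (single H s * star f) := by rw [star_mul, star_star]
  rw [h, star_apply, single_mul_apply hs, star_apply, star_star]
  simp

theorem single_mul_single (hs : ∀ h ∈ H, s⁻¹ * h * s ∈ H) (ht : ∀ h ∈ H, t⁻¹ * h * t ∈ H) :
    single H s * single H t = single H (s * t) := by
  have hst : ∀ h ∈ H, (s * t)⁻¹ * h * (s * t) ∈ H := fun h hh => by
    simpa [mul_assoc] using ht _ (hs h hh)
  ext γ
  rw [single_mul_apply hs, single_apply_of_conj_mem ht, single_apply_of_conj_mem hst, mul_inv_rev,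
    mul_assoc]

theorem finite_image_toRightCoset (γ : G) :
    (toRightCoset H '' DoubleCoset.doubleCoset γ (H : Set G) (H : Set G)).Finite := by
  refine (single H γ).finite_rightCosets.subset ?_
  rintro _ ⟨x, hx, rfl⟩
  obtain ⟨h, hh, e⟩ := exists_out_toRightCoset (H := H) x
  rw [Set.mem_ofPred_eq, e, (single H γ).left_inv hh, single_apply, Set.indicator_of_mem hx]
  exact one_ne_zero

theorem heckeR_ne_zero (γ : G) : heckeR H γ ≠ 0 := by
  exact ((Set.ncard_pos (finite_image_toRightCoset γ)).2
    ⟨_, γ, DoubleCoset.mem_doubleCoset_self H H γ, rfl⟩).ne'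

theorem finsum_single (γ : G) : ∑ᶠ q : RightCosets H, single H γ q.out = heckeR H γ := by
  classical
  have h : ∀ q : RightCosets H, single H γ q.out =
      if q ∈ toRightCoset H '' DoubleCoset.doubleCoset γ (H : Set G) (H : Set G) then 1 else 0 := by
    intro q
    rw [single_apply, Set.indicator_apply]
    refine if_congr ⟨fun hq => ⟨_, hq, toRightCoset_out q⟩, ?_⟩ rfl rfl
    rintro ⟨x, hx, rfl⟩
    obtain ⟨h, hh, e⟩ := exists_out_toRightCoset (H := H) x
    rw [mem_doubleCoset_iff_mk_eq] at hx ⊢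
    rw [← hx, e]
    exact ((DoubleCoset.eq H H _ _).2 ⟨h, hh, 1, H.one_mem, by simp⟩).symm
  have hfin := finite_image_toRightCoset (H := H) γ
  rw [finsum_congr h, heckeR, Set.ncard_eq_toFinset_card _ hfin, finsum_eq_sum_of_support_subset
    (s := hfin.toFinset) _ (fun q hq => ?_)]
  · rw [Finset.sum_congr rfl (fun q hq => if_pos (hfin.mem_toFinset.1 hq))]
    simp
  · rw [Set.Finite.coe_toFinset]
    by_contra hq'
    exact hq (if_neg hq')

/-- If `q` and `q * γ⁻¹` both lie in `s H`, then `γ ∈ H`. For such `γ` the sum counts the right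
cosets in the double coset of `s`. -/
theorem star_single_mul_single (hs : ∀ h ∈ H, s⁻¹ * h * s ∈ H) :
    star (single H s) * single H s = (heckeR H s : ℂ) • (1 : HeckeAlgebra H) := by
  ext γ
  classical
  have h : ∀ q : RightCosets H, star (single H s) (γ * q.out⁻¹) * single H s q.out =
      single H s q.out * (if γ ∈ H then 1 else 0) := fun q => by
    rw [star_apply, mul_inv_rev, inv_inv, single_apply_of_conj_mem hs, single_apply_of_conj_mem hs]
    by_cases hq : s⁻¹ * q.out ∈ H
    · rw [← mul_assoc, H.mul_mem_cancel_left hq, H.inv_mem_iff]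
      split_ifs <;> simp
    · simp [hq]
  rw [mul_apply, finsum_congr h, ← finsum_mul, finsum_single, smul_apply, one_apply,
    Set.indicator_apply]
  rfl

/-- Compute `star f * f` for `f = single H s * single H t` in two ways and compare values at the
identity. -/
theorem heckeR_mul (hs : ∀ h ∈ H, s⁻¹ * h * s ∈ H) (ht : ∀ h ∈ H, t⁻¹ * h * t ∈ H) :
    heckeR H (s * t) = heckeR H s * heckeR H t := by
  have hst : ∀ h ∈ H, (s * t)⁻¹ * h * (s * t) ∈ H := fun h hh => by
    simpa [mul_assoc] using ht _ (hs h hh)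
  have h := star_single_mul_single hst
  rw [← single_mul_single hs ht, star_mul, mul_assoc, ← mul_assoc (star (single H s)),
    star_single_mul_single hs, smul_mul_assoc, one_mul, mul_smul_comm, star_single_mul_single ht,
    smul_smul] at h
  have h1 := DFunLike.congr_fun h 1
  simp only [smul_apply, one_apply] at h1
  rw [Set.indicator_of_mem H.one_mem] at h1
  simp only [Pi.one_apply, mul_one] at h1
  exact_mod_cast h1.symm

end Single

section Support

variable [IsHeckePair H]

/-- The functions supported in a subgroup `L` containing `H`. -/
def supported (L : Subgroup G) (hL : H ≤ L) : Subalgebra ℂ (HeckeAlgebra H) where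
  carrier := {f | ∀ γ ∉ L, f γ = 0}
  mul_mem' {f g} hf hg γ hγ := by
    rw [mul_apply]
    refine finsum_eq_zero_of_forall_eq_zero fun q => ?_
    by_cases hq : q.out ∈ L
    · rw [hf _ fun h => hγ ((L.mul_mem_cancel_right (L.inv_mem hq)).1 h), zero_mul]
    · rw [hg _ hq, mul_zero]
  add_mem' {f g} hf hg γ hγ := by rw [add_apply, hf γ hγ, hg γ hγ, add_zero]
  algebraMap_mem' c γ hγ := by
    rw [Algebra.algebraMap_eq_smul_one, smul_apply, one_apply,
      Set.indicator_of_notMem fun h => hγ (hL h), mul_zero]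

/-- Right invariance determines a function supported on `L` by its values at representatives of the
finitely many cosets in `L / H`. -/
theorem finiteDimensional_supported (L : Subgroup G) (hL : H ≤ L)
    (hfin : ((fun x : G => (x : G ⧸ H)) '' (L : Set G)).Finite) :
    FiniteDimensional ℂ (supported L hL) := by
  have := hfin.to_subtype
  let F : supported L hL →ₗ[ℂ] ((fun x : G => (x : G ⧸ H)) '' (L : Set G)) → ℂ :=
    LinearMap.pi fun t => evalₗ t.1.out ∘ₗ (supported L hL).val.toLinearMap
  refine FiniteDimensional.of_injective F fun f g hfg => ?_
  ext γ
  by_cases hγ : γ ∈ L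
  · have h := congrFun hfg ⟨(γ : G ⧸ H), γ, hγ, rfl⟩
    change f.1 (γ : G ⧸ H).out = g.1 (γ : G ⧸ H).out at h
    obtain ⟨k, hk⟩ := QuotientGroup.mk_out_eq_mul H γ
    rwa [hk, f.1.right_inv k.2, g.1.right_inv k.2] at h
  · rw [f.2 γ hγ, g.2 γ hγ]

theorem isIntegral_of_support_subset (L : Subgroup G) (hL : H ≤ L)
    (hfin : ((fun x : G => (x : G ⧸ H)) '' (L : Set G)).Finite) {f : HeckeAlgebra H}
    (hf : ∀ γ ∉ L, f γ = 0) : IsIntegral ℂ f := by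
  have := finiteDimensional_supported L hL hfin
  exact IsIntegral.of_mem_of_fg (supported L hL)
    ((Submodule.fg_top _).1 (Module.Finite.fg_top (R := ℂ) (M := supported L hL))) f hf

end Support

section Subgroup

variable (N : Subgroup G)

theorem isHeckePair_subgroupOf [IsHeckePair H] : IsHeckePair (H.subgroupOf N) where
  finite_leftCosets γ := by
    have h := IsHeckePair.finite_leftCosets (H := H) (γ : G)
    let e : N ⧸ H.subgroupOf N → G ⧸ H := Quotient.map' Subtype.val fun a b hab => by
      rw [QuotientGroup.leftRel_apply] at hab ⊢
      exact hab
    have he : Function.Injective e := by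
      rintro ⟨a⟩ ⟨b⟩ hab
      exact QuotientGroup.eq.2 (QuotientGroup.eq.1 hab : (a : G)⁻¹ * b ∈ H)
    refine Set.Finite.of_finite_image (h.subset ?_) he.injOn
    rintro _ ⟨_, ⟨x, hx, rfl⟩, rfl⟩
    obtain ⟨h, hh, k, hk, rfl⟩ := DoubleCoset.mem_doubleCoset.1 hx
    exact ⟨_, DoubleCoset.mem_doubleCoset.2 ⟨h, hh, k, hk, rfl⟩, rfl⟩

variable {N} (hN : H ≤ N)

/-- Restriction of functions to a subgroup `N` containing `H`. -/
def restrict (hN : H ≤ N) : HeckeAlgebra H →ₗ[ℂ] HeckeAlgebra (H.subgroupOf N) where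
  toFun f := ⟨fun y => f y, fun h hh x => f.left_inv hh x, fun h hh x => f.right_inv hh x, by
    refine Set.Finite.of_finite_image
      (f := fun d => DoubleCoset.mk H H (d.out : G)) (f.finite_doubleCosets.subset ?_) ?_
    · rintro _ ⟨_, ⟨y, hy, rfl⟩, rfl⟩
      obtain ⟨h, k, hh, hk, e⟩ := DoubleCoset.mk_out_eq_mul (H.subgroupOf N) (H.subgroupOf N) y
      refine ⟨y, hy, (DoubleCoset.eq H H _ _).2 ⟨h, hh, k, hk, ?_⟩⟩
      rw [e]
      rfl
    -- Double cosets of `N` that are distinct stay distinct in `G`, as the elements of `H` that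
    -- would link them already lie in `N`.
    · intro d _ e _ hde
      obtain ⟨h, hh, k, hk, e'⟩ := (DoubleCoset.eq H H _ _).1 hde
      rw [← DoubleCoset.out_eq' _ _ d, ← DoubleCoset.out_eq' _ _ e]
      exact (DoubleCoset.eq _ _ _ _).2 ⟨⟨h, hN hh⟩, hh, ⟨k, hN hk⟩, hk, Subtype.ext e'⟩⟩
  map_add' _ _ := rfl
  map_smul' _ _ := rfl

theorem restrict_apply (f : HeckeAlgebra H) (y : N) : restrict hN f y = f y := rfl

open Classical in
/-- Extension of functions on a subgroup `N` containing `H` by zero. -/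
noncomputable def extendFun (hN : H ≤ N) (f : HeckeAlgebra (H.subgroupOf N)) : HeckeAlgebra H :=
  ⟨fun γ => if h : γ ∈ N then f ⟨γ, h⟩ else 0, by
    refine ⟨fun h hh x => ?_, fun h hh x => ?_, ?_⟩ <;> beta_reduce
    · by_cases hx : x ∈ N
      · rw [dif_pos hx, dif_pos (N.mul_mem (hN hh) hx)]
        exact f.left_inv (h := ⟨h, hN hh⟩) hh ⟨x, hx⟩
      · rw [dif_neg hx, dif_neg fun h' => hx ((N.mul_mem_cancel_left (hN hh)).1 h')]
    · by_cases hx : x ∈ N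
      · rw [dif_pos hx, dif_pos (N.mul_mem hx (hN hh))]
        exact f.right_inv (h := ⟨h, hN hh⟩) hh ⟨x, hx⟩
      · rw [dif_neg hx, dif_neg fun h' => hx ((N.mul_mem_cancel_right (hN hh)).1 h')]
    · refine (f.finite_doubleCosets.image fun d => DoubleCoset.mk H H (d.out : G)).subset ?_
      rintro _ ⟨x, hx, rfl⟩
      have hxN : x ∈ N := by
        by_contra hxN
        exact hx (dif_neg hxN)
      refine ⟨_, ⟨⟨x, hxN⟩, by simpa [hxN] using hx, rfl⟩, ?_⟩
      obtain ⟨h, k, hh, hk, e⟩ := DoubleCoset.mk_out_eq_mul (H.subgroupOf N) (H.subgroupOf N) ⟨x, hxN⟩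
      refine ((DoubleCoset.eq H H _ _).2 ⟨h, hh, k, hk, ?_⟩).symm
      rw [e]
      rfl⟩

theorem extendFun_coe (f : HeckeAlgebra (H.subgroupOf N)) (y : N) : extendFun hN f y = f y :=
  dif_pos y.2

theorem extendFun_of_notMem (f : HeckeAlgebra (H.subgroupOf N)) {γ : G} (hγ : γ ∉ N) :
    extendFun hN f γ = 0 :=
  dif_neg hγ

theorem ext_of_subgroup {f g : HeckeAlgebra H} (h : ∀ y : N, f y = g y)
    (h' : ∀ γ ∉ N, f γ = g γ) : f = g := by
  ext γ
  by_cases hγ : γ ∈ N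
  · exact h ⟨γ, hγ⟩
  · exact h' γ hγ

theorem extendFun_mul [IsHeckePair H] [IsHeckePair (H.subgroupOf N)]
    (f g : HeckeAlgebra (H.subgroupOf N)) :
    extendFun hN (f * g) = extendFun hN f * extendFun hN g := by
  refine ext_of_subgroup (N := N) (fun y => ?_) fun γ hγ => ?_
  · rw [extendFun_coe, mul_apply, mul_apply]
    -- The right cosets of `H` in `N` embed in those in `G`; on the remaining cosets the extension
    -- of `g` vanishes, so the two sums agree.
    let e : RightCosets (H.subgroupOf N) → RightCosets H := fun q => toRightCoset H (q.out : G)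
    have he : Function.Injective e := fun p q hpq => by
      rw [← toRightCoset_out p, ← toRightCoset_out q]
      have hpq' : (q.out : G) * (p.out : G)⁻¹ ∈ H := toRightCoset_eq_iff.1 hpq
      exact toRightCoset_eq_iff.2 hpq'
    rw [← finsum_mem_univ fun q : RightCosets H => extendFun hN f (y * q.out⁻¹) *
      extendFun hN g q.out, finsum_mem_inter_support_eq' _ Set.univ (Set.range e), finsum_mem_range he]
    · refine finsum_congr fun q => ?_
      obtain ⟨h, hh, e⟩ := exists_out_toRightCoset (H := H) (q.out : G)
      rw [e, summand_inv (extendFun hN f) (extendFun hN g) y h hh, extendFun_coe]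
      exact congrArg (· * _) (extendFun_coe hN f (y * q.out⁻¹)).symm
    · intro q hq
      refine iff_of_true trivial ?_
      have hqN : q.out ∈ N := by
        by_contra hqN
        exact right_ne_zero_of_mul hq (extendFun_of_notMem hN g hqN)
      refine ⟨toRightCoset _ ⟨q.out, hqN⟩, ?_⟩
      obtain ⟨h, hh, e⟩ := exists_out_toRightCoset (H := H.subgroupOf N) ⟨q.out, hqN⟩
      conv_rhs => rw [← toRightCoset_out q]
      refine toRightCoset_eq_iff.2 ?_
      rw [e]
      simpa using H.inv_mem hh
  · rw [extendFun_of_notMem hN _ hγ, mul_apply]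
    refine (finsum_eq_zero_of_forall_eq_zero fun q => ?_).symm
    by_cases hq : q.out ∈ N
    · rw [extendFun_of_notMem hN f fun h => hγ ((N.mul_mem_cancel_right (N.inv_mem hq)).1 h),
        zero_mul]
    · rw [extendFun_of_notMem hN g hq, mul_zero]

variable [IsHeckePair H] [IsHeckePair (H.subgroupOf N)]

/-- Extension by zero as a homomorphism of Hecke algebras. -/
noncomputable def extend (hN : H ≤ N) : HeckeAlgebra (H.subgroupOf N) →⋆ₐ[ℂ] HeckeAlgebra H :=
  have hone : extendFun hN 1 = 1 := by
    classical
    refine ext_of_subgroup (N := N) (fun y => ?_) fun γ hγ => ?_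
    · rw [extendFun_coe, one_apply, one_apply, Set.indicator_apply, Set.indicator_apply]
      rfl
    · rw [extendFun_of_notMem hN _ hγ, one_apply, Set.indicator_of_notMem fun h => hγ (hN h)]
  have hsmul (c : ℂ) (f) : extendFun hN (c • f) = c • extendFun hN f :=
    ext_of_subgroup (N := N) (fun y => by simp [extendFun_coe]) fun γ hγ => by
      simp [extendFun_of_notMem hN _ hγ]
  { toFun := extendFun hN
    map_one' := hone
    map_mul' := extendFun_mul hN
    map_zero' := ext_of_subgroup (N := N) (fun y => by simp [extendFun_coe]) fun γ hγ => by
      simp [extendFun_of_notMem hN _ hγ]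
    map_add' := fun f g => ext_of_subgroup (N := N) (fun y => by simp [extendFun_coe]) fun γ hγ => by
      simp [extendFun_of_notMem hN _ hγ]
    commutes' := fun c => by
      rw [Algebra.algebraMap_eq_smul_one, Algebra.algebraMap_eq_smul_one, hsmul, hone]
    map_star' := fun f => ext_of_subgroup (N := N)
      (fun y => by
        rw [extendFun_coe, star_apply, star_apply, ← extendFun_coe hN f]
        rfl)
      fun γ hγ => by
        rw [extendFun_of_notMem hN _ hγ, star_apply,
          extendFun_of_notMem hN _ fun h => hγ (N.inv_mem_iff.1 h), star_zero] }

theorem extend_coe (f : HeckeAlgebra (H.subgroupOf N)) (y : N) : extend hN f y = f y :=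
  extendFun_coe hN f y

theorem extend_of_notMem (f : HeckeAlgebra (H.subgroupOf N)) {γ : G} (hγ : γ ∉ N) :
    extend hN f γ = 0 :=
  extendFun_of_notMem hN f hγ

theorem restrict_extend (f : HeckeAlgebra (H.subgroupOf N)) : restrict hN (extend hN f) = f := by
  ext y
  rw [restrict_apply, extend_coe]

theorem extend_restrict {f : HeckeAlgebra H} (hf : ∀ γ ∉ N, f γ = 0) :
    extend hN (restrict hN f) = f :=
  ext_of_subgroup (N := N) (fun y => by rw [extend_coe, restrict_apply])
    fun γ hγ => by rw [extend_of_notMem hN _ hγ, hf γ hγ]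

theorem extend_injective : Function.Injective (extend hN : HeckeAlgebra (H.subgroupOf N) → _) :=
  Function.LeftInverse.injective (restrict_extend hN)

end Subgroup

end HeckeAlgebra

/-- A homomorphism that is trivial on units descends to the associates. -/
def Associates.liftHom {M P : Type*} [CommMonoid M] [Monoid P] (f : M →* P)
    (hf : ∀ u : Mˣ, f u = 1) : Associates M →* P where
  toFun := Quotient.lift f fun a b ⟨u, hu⟩ => by rw [← hu, map_mul, hf, mul_one]
  map_one' := map_one f
  map_mul' := by
    rintro ⟨a⟩ ⟨b⟩
    exact map_mul f a b

/-! ### Actions by conjugation with isometries -/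

section IsometryAction

variable {S A B : Type*} [Monoid S] [Ring A] [StarRing A] [Algebra ℂ A]
  [Ring B] [StarRing B] [Algebra ℂ B]

/-- The action on a subalgebra by conjugation with isometries that leave it invariant. -/
def isometryAction (j : A →⋆ₐ[ℂ] B) (E : B →ₗ[ℂ] A) (hE : ∀ a, E (j a) = a) (V : S →* B)
    (hV : ∀ s, star (V s) * V s = 1)
    (hVE : ∀ s a, j (E (V s * j a * star (V s))) = V s * j a * star (V s)) :
    S →* (A →⋆ₙₐ[ℂ] A) :=
  have hj : Function.Injective j := Function.LeftInverse.injective (g := E) hE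
  { toFun := fun s =>
      { toFun := fun a => E (V s * j a * star (V s))
        map_smul' := fun c a => by simp
        map_zero' := by simp
        map_add' := fun a b => by simp [mul_add, add_mul]
        map_mul' := fun a b => hj <| by
          rw [hVE, map_mul j, map_mul j, hVE, hVE]
          simp only [mul_assoc]
          rw [← mul_assoc (star (V s)) (V s), hV, one_mul]
        map_star' := fun a => hj <| by
          rw [hVE, map_star j, map_star j, hVE]
          simp only [star_mul, star_star, mul_assoc] }
    map_one' := by
      ext a
      change E (V 1 * j a * star (V 1)) = a
      rw [map_one, star_one, one_mul, mul_one, hE]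
    map_mul' := fun s t => by
      ext a
      refine hj ?_
      change j (E (V (s * t) * j a * star (V (s * t)))) =
        j (E (V s * j (E (V t * j a * star (V t))) * star (V s)))
      rw [hVE, hVE, hVE, map_mul, star_mul]
      simp only [mul_assoc] }

theorem isCovariantRep_isometryAction {j : A →⋆ₐ[ℂ] B} {E : B →ₗ[ℂ] A} (hE : ∀ a, E (j a) = a)
    {V : S →* B} (hV : ∀ s, star (V s) * V s = 1)
    (hVE : ∀ s a, j (E (V s * j a * star (V s))) = V s * j a * star (V s)) :
    IsCovariantRep (isometryAction j E hE V hV hVE) j V :=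
  ⟨hV, hVE⟩

end IsometryAction

/-! ### The isometries, the grading and uniform bounds in an abstract Hecke setting -/

section Scaling

variable {G Q M : Type*} [Group G] [CommGroup Q] [CommMonoid M]

/-- A semigroup of elements `σ a` of `G` with `(σ a)⁻¹ H (σ a) ≤ H` such that `G / N` is the group
of fractions of its classes modulo units. -/
structure IsHeckeScaling (H N : Subgroup G) (σ : M →* G) (deg : G →* Q) : Prop where
  le : H ≤ N
  mem_iff : ∀ γ, γ ∈ N ↔ deg γ = 1
  conj_mem : ∀ a, ∀ h ∈ H, (σ a)⁻¹ * h * σ a ∈ H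
  unit_mem : ∀ u : Mˣ, σ u ∈ H
  associated : ∀ a b, deg (σ a) = deg (σ b) → Associated a b
  exists_mul_eq : ∀ x, ∃ a b, deg (σ a) * x = deg (σ b)

namespace IsHeckeScaling

open HeckeAlgebra hiding add_apply smul_apply

theorem inv_sqrt_mul_self (γ : G) : (((Real.sqrt (heckeR H γ))⁻¹ : ℝ) : ℂ) *
    (((Real.sqrt (heckeR H γ))⁻¹ : ℝ) : ℂ) = (heckeR H γ : ℂ)⁻¹ := by
  rw [← Complex.ofReal_mul, ← mul_inv, Real.mul_self_sqrt (Nat.cast_nonneg _)]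
  simp

theorem deg_conj (σ : M →* G) (deg : G →* Q) (a : M) (γ : G) : deg ((σ a)⁻¹ * γ * σ a) = deg γ := by
  rw [map_mul, map_mul, map_inv, mul_comm, mul_inv_cancel_left]

/-- The functions supported on the elements of degree `x`. -/
def homogeneous (H : Subgroup G) (deg : G →* Q) (x : Q) : Submodule ℂ (HeckeAlgebra H) where
  carrier := {f | ∀ γ, deg γ ≠ x → f γ = 0}
  zero_mem' _ _ := rfl
  add_mem' {f g} hf hg γ hγ := by rw [HeckeAlgebra.add_apply, hf γ hγ, hg γ hγ, add_zero]
  smul_mem' c f hf γ hγ := by rw [HeckeAlgebra.smul_apply, hf γ hγ, mul_zero]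

variable {H N : Subgroup G} {σ : M →* G} {deg : G →* Q} (h : IsHeckeScaling H N σ deg)
include h

theorem deg_of_mem {x : G} (hx : x ∈ H) : deg x = 1 := (h.mem_iff x).1 (h.le hx)

/-- The homomorphism from classes modulo units to `Q`. -/
def degHom : Associates M →* Q :=
  Associates.liftHom (deg.comp σ) fun u => h.deg_of_mem (h.unit_mem u)

theorem single_mem (γ : G) : single H γ ∈ homogeneous H deg (deg γ) := by
  intro x hx
  rw [single_apply]
  refine Set.indicator_of_notMem (fun hmem => hx ?_) _
  obtain ⟨k, hk, l, hl, rfl⟩ := DoubleCoset.mem_doubleCoset.1 hmem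
  rw [map_mul, map_mul, h.deg_of_mem hk, h.deg_of_mem hl, one_mul, mul_one]

variable [IsHeckePair H]

/-- The isometries `R(σ a)^{-1/2} [σ a]`. -/
noncomputable def isometry : Associates M →* HeckeAlgebra H :=
  -- When `σ a` lies in `H`, its double coset is `H` and `R(σ a) = 1`. This yields both the value at
  -- `1` and the descent to classes modulo units.
  have key (a : M) (ha : σ a ∈ H) :
      (((Real.sqrt (heckeR H (σ a)))⁻¹ : ℝ) : ℂ) • single H (σ a) = 1 := by
    have h1 := star_single_mul_single (h.conj_mem a)
    have h2 := DFunLike.congr_fun h1 1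
    rw [single_eq_one_of_mem ha, star_one, one_mul, HeckeAlgebra.smul_apply, one_apply,
      Set.indicator_of_mem H.one_mem] at h2
    have h3 : heckeR H (σ a) = 1 := by
      simp only [Pi.one_apply, mul_one] at h2
      exact_mod_cast h2.symm
    rw [single_eq_one_of_mem ha, h3]
    simp
  Associates.liftHom
    { toFun := fun a => (((Real.sqrt (heckeR H (σ a)))⁻¹ : ℝ) : ℂ) • single H (σ a)
      map_one' := key 1 (by rw [map_one]; exact H.one_mem)
      map_mul' := fun a b => by
        rw [smul_mul_smul_comm, single_mul_single (h.conj_mem a) (h.conj_mem b), map_mul,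
          heckeR_mul (h.conj_mem a) (h.conj_mem b), Nat.cast_mul, Real.sqrt_mul (Nat.cast_nonneg _),
          mul_inv, Complex.ofReal_mul] }
    fun u => key u (h.unit_mem u)

theorem isometry_mk (a : M) : h.isometry (Associates.mk a) =
    (((Real.sqrt (heckeR H (σ a)))⁻¹ : ℝ) : ℂ) • single H (σ a) := rfl

theorem star_isometry_mul_isometry (s : Associates M) :
    star (h.isometry s) * h.isometry s = 1 := by
  obtain ⟨a, rfl⟩ := Associates.mk_surjective s
  rw [isometry_mk, star_smul, smul_mul_smul_comm, star_single_mul_single (h.conj_mem a), smul_smul,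
    RCLike.star_def, Complex.conj_ofReal, inv_sqrt_mul_self,
    inv_mul_cancel₀ (Nat.cast_ne_zero.2 (heckeR_ne_zero _)), one_smul]

theorem isometry_conj_apply (a : M) (f : HeckeAlgebra H) (γ : G) :
    (h.isometry (Associates.mk a) * f * star (h.isometry (Associates.mk a))) γ =
      (heckeR H (σ a) : ℂ)⁻¹ * f ((σ a)⁻¹ * γ * σ a) := by
  rw [isometry_mk, star_smul, smul_mul_assoc, smul_mul_smul_comm, RCLike.star_def,
    Complex.conj_ofReal, inv_sqrt_mul_self, HeckeAlgebra.smul_apply, mul_star_single_apply (h.conj_mem a),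
    single_mul_apply (h.conj_mem a), mul_assoc (σ a)⁻¹]

variable [IsHeckePair (H.subgroupOf N)]

/-- Conjugation by `σ a` preserves degrees because `Q` is commutative, so support in `N` is
preserved. -/
theorem extend_restrict_conj (s : Associates M) (f : HeckeAlgebra (H.subgroupOf N)) :
    extend h.le (restrict h.le (h.isometry s * extend h.le f * star (h.isometry s))) =
      h.isometry s * extend h.le f * star (h.isometry s) := by
  obtain ⟨a, rfl⟩ := Associates.mk_surjective s
  refine extend_restrict h.le fun γ hγ => ?_
  rw [isometry_conj_apply, extend_of_notMem, mul_zero]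
  rwa [h.mem_iff, deg_conj, ← h.mem_iff]

/-- The action on the Hecke algebra of `N` by conjugation with the isometries. -/
noncomputable def action : Associates M →*
    (HeckeAlgebra (H.subgroupOf N) →⋆ₙₐ[ℂ] HeckeAlgebra (H.subgroupOf N)) :=
  isometryAction (extend h.le) (restrict h.le) (restrict_extend h.le) h.isometry
    h.star_isometry_mul_isometry h.extend_restrict_conj

theorem action_mk_apply [N.Normal] (a : M) (f : HeckeAlgebra (H.subgroupOf N)) (y : N) :
    h.action (Associates.mk a) f y =
      (heckeR H (σ a) : ℂ)⁻¹ * f (MulAut.conjNormal (σ a)⁻¹ y) := by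
  change (h.isometry (Associates.mk a) * extend h.le f * star (h.isometry (Associates.mk a))) y = _
  rw [isometry_conj_apply, ← extend_coe h.le f, MulAut.conjNormal_apply, inv_inv]

theorem isCovariantGrading : IsCovariantGrading h.action (extend h.le) h.isometry
    (homogeneous H deg) h.degHom (restrict h.le) where
  covariantRep := isCovariantRep_isometryAction _ _ _
  mul_mem {x y f g} hf hg γ hγ := by
    rw [mul_apply]
    refine finsum_eq_zero_of_forall_eq_zero fun q => ?_
    by_cases hq : deg q.out = y
    · rw [hf _ fun h' => hγ ?_, zero_mul]
      rw [← h', ← hq, ← map_mul, inv_mul_cancel_right]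
    · rw [hg _ hq, mul_zero]
  star_mem {x f} hf γ hγ := by
    rw [star_apply, hf _ fun h' => hγ ?_, star_zero]
    rw [← h', map_inv, inv_inv]
  iSup_eq_top := by
    refine top_unique ?_
    rw [← span_range_single, Submodule.span_le]
    rintro _ ⟨γ, rfl⟩
    exact Submodule.mem_iSup_of_mem (deg γ) (h.single_mem γ)
  injective := by
    intro s t hst
    obtain ⟨a, rfl⟩ := Associates.mk_surjective s
    obtain ⟨b, rfl⟩ := Associates.mk_surjective t
    exact Associates.mk_eq_mk_iff_associated.2 (h.associated a b hst)
  exists_mul_eq x := by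
    obtain ⟨a, b, hab⟩ := h.exists_mul_eq x
    exact ⟨Associates.mk a, Associates.mk b, hab⟩
  isometry_mem s := by
    obtain ⟨a, rfl⟩ := Associates.mk_surjective s
    exact Submodule.smul_mem _ _ (h.single_mem (σ a))
  map_mem f γ hγ := extend_of_notMem h.le f fun h' => hγ ((h.mem_iff γ).1 h')
  map_expectation hf := extend_restrict h.le fun γ hγ => hf γ fun h' => hγ ((h.mem_iff γ).2 h')
  expectation_of_ne {x f} hx hf := by
    ext y
    exact hf y fun h' => hx (h'.symm.trans ((h.mem_iff y).1 y.2))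
  expectation_map := restrict_extend h.le

/-- It suffices to treat the characteristic function of one double coset. Its product with its
adjoint is self-adjoint and lives in the finite-dimensional algebra of functions supported on `L`,
so it is algebraic. Integrality is tested in the larger Hecke algebra through the injective
extension by zero. -/
theorem isCStarBounded_subgroupOf (hfin : ∀ y ∈ N, ∃ L : Subgroup G, H ≤ L ∧ y ∈ L ∧
      ((fun x : G => (x : G ⧸ H)) '' (L : Set G)).Finite) (f : HeckeAlgebra (H.subgroupOf N)) :
    IsCStarBounded f := by
  have hf : f ∈ Submodule.span ℂ (Set.range (single (H.subgroupOf N))) := by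
    rw [span_range_single]
    trivial
  induction hf using Submodule.span_induction with
  | zero => exact .zero
  | add f g _ _ hf hg => exact hf.add hg
  | smul c f _ hf => exact hf.smul c
  | mem f hf =>
    obtain ⟨y, rfl⟩ := hf
    obtain ⟨L, hL, hy, hLfin⟩ := hfin y y.2
    refine .of_star_mul_self (.of_isIntegral (.star_mul_self _) ?_)
    have hinj : Function.Injective
        (extend h.le : HeckeAlgebra (H.subgroupOf N) →ₐ[ℂ] HeckeAlgebra H) := extend_injective h.le
    rw [← isIntegral_algHom_iff _ hinj]
    have hsupp : extend h.le (single (H.subgroupOf N) y) ∈ supported L hL := by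
      refine fun γ hγ => ?_
      by_cases hγN : γ ∈ N
      · have : extend h.le (single (H.subgroupOf N) y) γ = _ := extend_coe h.le _ ⟨γ, hγN⟩
        rw [this, single_apply, Set.indicator_of_notMem fun hmem => hγ ?_]
        obtain ⟨k, hk, l, hl, e⟩ := DoubleCoset.mem_doubleCoset.1 hmem
        have e' : γ = (k : G) * y * l := congrArg Subtype.val e
        rw [e']
        exact L.mul_mem (L.mul_mem (hL hk) hy) (hL hl)
      · exact extend_of_notMem h.le _ hγN
    refine isIntegral_of_support_subset L hL hLfin (fun γ hγ => ?_)
    change extend h.le (star (single (H.subgroupOf N) y) * single (H.subgroupOf N) y) γ = 0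
    rw [map_mul, map_star]
    refine (supported L hL).mul_mem (fun γ hγ => ?_) hsupp γ hγ
    rw [star_apply, hsupp _ fun h' => hγ (L.inv_mem_iff.1 h'), star_zero]

/-- The algebra is generated by the image of the Hecke algebra of `N`, where bounds are inherited by
pulling seminorms back, and by the isometries. -/
theorem isCStarBounded (hN : ∀ f : HeckeAlgebra (H.subgroupOf N), IsCStarBounded f)
    (f : HeckeAlgebra H) : IsCStarBounded f := by
  refine IsCStarBounded.of_mem_adjoin (s := Set.range (extend h.le) ∪ Set.range h.isometry) ?_ ?_
  · rintro _ (⟨g, rfl⟩ | ⟨s, rfl⟩)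
    · exact (hN g).map (extend h.le : HeckeAlgebra (H.subgroupOf N) →⋆ₙₐ[ℂ] HeckeAlgebra H)
    · exact .of_isometry (h.star_isometry_mul_isometry s)
  · rw [h.isCovariantGrading.adjoin_eq_top]
    trivial

end IsHeckeScaling

end Scaling

/-- An action on a `*`-algebra extends to its enveloping C*-algebra. -/
theorem exists_action_extension {S A C : Type*} [Monoid S] [Ring A] [StarRing A] [Algebra ℂ A]
    [CStarAlgebra C] {ι : A →⋆ₐ[ℂ] C} (hd : DenseRange ι)
    (hp : ∀ p : Seminorm ℂ A, IsCStarSeminorm p → ∀ a, p a ≤ ‖ι a‖) (α : S →* (A →⋆ₙₐ[ℂ] A)) :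
    ∃ β : S →* (C →⋆ₙₐ[ℂ] C), ∀ s a, β s (ι a) = ι (α s a) := by
  choose β hβ using fun s => exists_nonUnitalStarAlgHom_extension hd hp
    ((ι : A →⋆ₙₐ[ℂ] C).comp (α s))
  have hβ' : ∀ s a, β s (ι a) = ι (α s a) := hβ
  refine ⟨⟨⟨β, ?_⟩, fun s t => ?_⟩, hβ'⟩
  · refine nonUnitalStarAlgHom_eq_of_denseRange hd fun a => ?_
    rw [hβ', map_one]
    rfl
  · refine nonUnitalStarAlgHom_eq_of_denseRange hd fun a => ?_
    change β (s * t) (ι a) = β s (β t (ι a))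
    rw [hβ', hβ', hβ', map_mul]
    rfl

/-! ### Denominators and the affine group of a number field -/

section NumberField

variable {K : Type*} [Field K]

theorem coe_mem_range_of_mem_integralUnits {x : Kˣ} (hx : x ∈ integralUnits K) :
    (x : K) ∈ (algebraMap (𝓞 K) K).range := by
  obtain ⟨w, rfl⟩ := hx
  exact ⟨w, rfl⟩

theorem mem_integralSubgroup_iff {γ : AffineGroup K} : γ ∈ integralSubgroup K ↔
    γ.left.toAdd ∈ (algebraMap (𝓞 K) K).range ∧ γ.right ∈ integralUnits K :=
  Iff.rfl

theorem affineGroup_mul_left_toAdd (γ δ : AffineGroup K) :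
    (γ * δ).left.toAdd = γ.left.toAdd + (γ.right : K)⁻¹ * δ.left.toAdd := by
  rw [SemidirectProduct.mul_left, affineAction_apply, toAdd_mul, toAdd_ofAdd, Units.val_inv_eq_inv_val]

theorem affineGroup_inv_left_toAdd (γ : AffineGroup K) :
    γ⁻¹.left.toAdd = -((γ.right : K) * γ.left.toAdd) := by
  rw [SemidirectProduct.inv_left, affineAction_apply, inv_inv, toAdd_ofAdd, toAdd_inv, mul_neg]

/-- The elements of `K ⋊ (𝓞 K)ˣ` whose translation part has denominator `n`. -/
def denominatorSubgroup (n : K) : Subgroup (AffineGroup K) where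
  carrier := {γ | n * γ.left.toAdd ∈ (algebraMap (𝓞 K) K).range ∧ γ.right ∈ integralUnits K}
  one_mem' := ⟨by simp, one_mem _⟩
  mul_mem' := by
    rintro γ δ ⟨hγ, hγ'⟩ ⟨hδ, hδ'⟩
    refine ⟨?_, mul_mem hγ' hδ'⟩
    rw [affineGroup_mul_left_toAdd, mul_add, mul_left_comm]
    refine add_mem hγ (mul_mem ?_ hδ)
    rw [← Units.val_inv_eq_inv_val]
    exact coe_mem_range_of_mem_integralUnits (inv_mem hγ')
  inv_mem' := by
    rintro γ ⟨hγ, hγ'⟩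
    refine ⟨?_, inv_mem hγ'⟩
    rw [affineGroup_inv_left_toAdd, mul_neg, mul_left_comm]
    exact neg_mem (mul_mem (coe_mem_range_of_mem_integralUnits hγ') hγ)

theorem integralSubgroup_le_denominatorSubgroup {n : K} (hn : n ∈ (algebraMap (𝓞 K) K).range) :
    integralSubgroup K ≤ denominatorSubgroup n :=
  fun _ hγ => ⟨mul_mem hn hγ.1, hγ.2⟩

variable (K) in
/-- `scaling` as a homomorphism. -/
noncomputable def scalingHom : (𝓞 K)⁰ →* AffineGroup K :=
  SemidirectProduct.inr.comp
    { toFun := fun a => Units.mk0 ((a : 𝓞 K) : K) (by simp)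
      map_one' := by ext; simp
      map_mul' := fun a b => by ext; simp }

theorem coe_scalingHom_right (a : (𝓞 K)⁰) : ((scalingHom K a).right : K) = (a : 𝓞 K) := rfl

theorem scalingHom_left (a : (𝓞 K)⁰) : (scalingHom K a).left.toAdd = 0 := rfl

variable (K) in
/-- The projection to `Kˣ ⧸ (𝓞 K)ˣ`. -/
def degreeHom : AffineGroup K →* Kˣ ⧸ integralUnits K :=
  (QuotientGroup.mk' (integralUnits K)).comp SemidirectProduct.rightHom

variable [NumberField K]

/-- A left coset of `integralSubgroup K` in this set is determined by the translation part in `n⁻¹ 𝓞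
K` modulo `x⁻¹ 𝓞 K`. Writing `x = p / q`, a change of the numerator by `n * q * t` changes the
translation by `q * t`, and `x * (q * t) = p * t` is integral. So the finite ring `𝓞 K ⧸ (n * q)`
parametrizes all the cosets. -/
theorem finite_leftCosets_of_denominator {n : 𝓞 K} (hn : n ≠ 0) (x : Kˣ) :
    ((fun γ : AffineGroup K => (γ : AffineGroup K ⧸ integralSubgroup K)) ''
      {γ | (n : K) * γ.left.toAdd ∈ (algebraMap (𝓞 K) K).range ∧
        γ.right * x⁻¹ ∈ integralUnits K}).Finite := by
  obtain ⟨p, q, hq, hpq⟩ := IsFractionRing.div_surjective (𝓞 K) (x : K)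
  have hq0 : q ≠ 0 := nonZeroDivisors.ne_zero hq
  have hnK : (n : K) ≠ 0 := by simpa using hn
  have hqK : (q : K) ≠ 0 := by simpa using hq0
  have : Finite (𝓞 K ⧸ Ideal.span {n * q}) :=
    Ideal.finiteQuotientOfFreeOfNeBot _ (by simpa using mul_ne_zero hn hq0)
  refine (Set.finite_range fun t : 𝓞 K ⧸ Ideal.span {n * q} =>
    ((⟨Multiplicative.ofAdd ((t.out : K) / n), x⟩ : AffineGroup K) :
      AffineGroup K ⧸ integralSubgroup K)).subset ?_
  rintro _ ⟨γ, ⟨⟨c, hc⟩, hγ⟩, rfl⟩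
  refine ⟨Ideal.Quotient.mk _ c, QuotientGroup.eq.2 (mem_integralSubgroup_iff.2 ⟨?_, ?_⟩)⟩
  · have hout : Ideal.Quotient.mk (Ideal.span {n * q}) c =
        Ideal.Quotient.mk _ (Ideal.Quotient.mk (Ideal.span {n * q}) c).out :=
      (Quotient.out_eq _).symm
    rw [Ideal.Quotient.eq, Ideal.mem_span_singleton] at hout
    obtain ⟨t, ht⟩ := hout
    set o := (Ideal.Quotient.mk (Ideal.span {n * q}) c).out
    have ht' : (c : K) - o = n * q * t := by exact_mod_cast congrArg (algebraMap (𝓞 K) K) ht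
    refine ⟨p * t, ?_⟩
    rw [affineGroup_mul_left_toAdd, affineGroup_inv_left_toAdd, SemidirectProduct.inv_right,
      Units.val_inv_eq_inv_val, inv_inv]
    have hl : γ.left.toAdd = (c : K) / n := by rw [eq_div_iff hnK, mul_comm, ← hc]
    rw [hl, map_mul]
    change (p : K) * t = -((x : K) * ((o : K) / n)) + x * ((c : K) / n)
    have hx : (x : K) = p / q := hpq.symm
    have hc' : (c : K) = o + n * q * t := by rw [← ht']; ring
    rw [hx, hc']
    field_simp
    ring
  · rw [SemidirectProduct.mul_right, SemidirectProduct.inv_right, mul_comm]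
    exact hγ

theorem exists_denominator (y : K) : ∃ n : 𝓞 K, n ≠ 0 ∧ (n : K) * y ∈ (algebraMap (𝓞 K) K).range := by
  obtain ⟨p, q, hq, rfl⟩ := IsFractionRing.div_surjective (𝓞 K) y
  have hq0 : q ≠ 0 := nonZeroDivisors.ne_zero hq
  exact ⟨q, hq0, p, by rw [mul_div_cancel₀ _ (by simpa using hq0)]⟩

instance isHeckePair_integralSubgroup : IsHeckePair (integralSubgroup K) where
  finite_leftCosets γ := by
    obtain ⟨m, hm, hmy⟩ := exists_denominator γ.left.toAdd
    obtain ⟨q, hq, hqx⟩ := exists_denominator (γ.right : K)⁻¹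
    -- The translation part of `h * γ * k` is a sum of an integer, a unit times that of `γ`, and a
    -- unit times `γ.right⁻¹` times an integer; `m * q` clears all three denominators.
    refine (finite_leftCosets_of_denominator (mul_ne_zero hm hq) γ.right).subset
      (Set.image_mono fun δ hδ => ?_)
    obtain ⟨h, hh, k, hk, rfl⟩ := DoubleCoset.mem_doubleCoset.1 hδ
    constructor
    · have hmR : (m : K) ∈ (algebraMap (𝓞 K) K).range := ⟨m, rfl⟩
      have hqR : (q : K) ∈ (algebraMap (𝓞 K) K).range := ⟨q, rfl⟩
      have huR := coe_mem_range_of_mem_integralUnits (inv_mem hh.2)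
      rw [Units.val_inv_eq_inv_val] at huR
      have hsum := add_mem (mul_mem (mul_mem hmR hqR) hh.1) (add_mem
        (mul_mem (mul_mem hqR huR) hmy) (mul_mem (mul_mem (mul_mem hmR huR) hqx) hk.1))
      convert hsum using 1
      rw [affineGroup_mul_left_toAdd, affineGroup_mul_left_toAdd, SemidirectProduct.mul_right,
        Units.val_mul, mul_inv, show ((m * q : 𝓞 K) : K) = m * q from map_mul _ m q]
      ring
    · rw [SemidirectProduct.mul_right, SemidirectProduct.mul_right, mul_right_comm,
        mul_inv_cancel_right]
      exact mul_mem hh.2 hk.2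

/-- A fixed denominator is preserved under products when the multiplicative parts are units, which
makes the finite set of cosets come from a subgroup. -/
theorem exists_denominatorSubgroup (γ : AffineGroup K) (hγ : γ ∈ unitSubgroup K) :
    ∃ L : Subgroup (AffineGroup K), integralSubgroup K ≤ L ∧ γ ∈ L ∧
      ((fun x : AffineGroup K => (x : AffineGroup K ⧸ integralSubgroup K)) ''
        (L : Set (AffineGroup K))).Finite := by
  obtain ⟨n, hn, hny⟩ := exists_denominator γ.left.toAdd
  refine ⟨denominatorSubgroup (n : K), integralSubgroup_le_denominatorSubgroup ⟨n, rfl⟩,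
    ⟨hny, hγ⟩, (finite_leftCosets_of_denominator hn 1).subset (Set.image_mono fun δ hδ => ?_)⟩
  exact ⟨hδ.1, by simpa using hδ.2⟩

variable (K) in
theorem isHeckeScaling_scalingHom : IsHeckeScaling (Q := Kˣ ⧸ integralUnits K) (integralSubgroup K) (unitSubgroup K)
    (scalingHom K) (degreeHom K) where
  le _ hγ := hγ.2
  mem_iff γ := (QuotientGroup.eq_one_iff (N := integralUnits K) γ.right).symm
  conj_mem a γ hγ := by
    refine mem_integralSubgroup_iff.2 ⟨?_, ?_⟩
    · rw [affineGroup_mul_left_toAdd, affineGroup_mul_left_toAdd, affineGroup_inv_left_toAdd,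
        scalingHom_left, SemidirectProduct.inv_right, Units.val_inv_eq_inv_val, inv_inv,
        coe_scalingHom_right]
      have haR : ((a : 𝓞 K) : K) ∈ (algebraMap (𝓞 K) K).range := ⟨_, rfl⟩
      simpa using mul_mem haR hγ.1
    · rw [SemidirectProduct.mul_right, SemidirectProduct.mul_right, SemidirectProduct.inv_right,
        mul_comm, mul_inv_cancel_left]
      exact hγ.2
  unit_mem u := mem_integralSubgroup_iff.2
    ⟨⟨0, by rw [map_zero, scalingHom_left]⟩, Units.map (𝓞 K)⁰.subtype u, by ext; rfl⟩
  associated a b hab := by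
    obtain ⟨w, hw⟩ := QuotientGroup.eq.1 hab
    refine nonZeroDivisors.associated_coe.1 ⟨w, ?_⟩
    have hw' : (scalingHom K b).right = (scalingHom K a).right * Units.map
        (algebraMap (𝓞 K) K).toMonoidHom w := by
      rw [hw]
      exact (mul_inv_cancel_left _ _).symm
    apply FaithfulSMul.algebraMap_injective (𝓞 K) K
    rw [map_mul]
    exact (congrArg Units.val hw').symm
  exists_mul_eq x := by
    obtain ⟨x, rfl⟩ := QuotientGroup.mk_surjective x
    obtain ⟨p, q, hq, hpq⟩ := IsFractionRing.div_surjective (𝓞 K) (x : K)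
    have hqK : (q : K) ≠ 0 := by simpa using nonZeroDivisors.ne_zero hq
    have hpK : (p : K) ≠ 0 := by
      intro h0
      exact x.ne_zero (hpq.symm.trans ((congrArg (· / _) h0).trans (zero_div _)))
    -- With `x = p / q`, the required fraction is `q * x = p`.
    refine ⟨⟨q, hq⟩, ⟨p, mem_nonZeroDivisors_of_ne_zero (by simpa using hpK)⟩, ?_⟩
    refine congrArg (QuotientGroup.mk' (integralUnits K)) (a₁ := (scalingHom K ⟨q, hq⟩).right * x) ?_
    ext
    change (q : K) * x = p
    rw [← hpq, mul_div_cancel₀ _ hqK]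

end NumberField

theorem mainTheorem9 (K : Type u) [Field K] [NumberField K]
    (hquad : Module.finrank ℚ K = 2) (himag : NumberField.IsTotallyComplex K) :
    ∃ (_ : IsHeckePair (integralSubgroup K))
      (_ : IsHeckePair ((integralSubgroup K).subgroupOf (unitSubgroup K)))
      -- the action on the Hecke algebra of `K ⋊ (𝓞 K)ˣ`
      (α : PrincipalIntegralIdeals K →*
        (HeckeAlgebra ((integralSubgroup K).subgroupOf (unitSubgroup K)) →⋆ₙₐ[ℂ]
          HeckeAlgebra ((integralSubgroup K).subgroupOf (unitSubgroup K))))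
      -- the canonical embedding, and the canonical isometries
      (j : HeckeAlgebra ((integralSubgroup K).subgroupOf (unitSubgroup K)) →⋆ₐ[ℂ]
        HeckeAlgebra (integralSubgroup K))
      (μ : PrincipalIntegralIdeals K →* HeckeAlgebra (integralSubgroup K)),
      (∀ (a : (𝓞 K)⁰) (f : HeckeAlgebra ((integralSubgroup K).subgroupOf (unitSubgroup K)))
        (y : unitSubgroup K),
        α (Associates.mk a) f y = (heckeR (integralSubgroup K) (scaling a) : ℂ)⁻¹ *
          f (MulAut.conjNormal (scaling a)⁻¹ y)) ∧
      (∀ (f : HeckeAlgebra ((integralSubgroup K).subgroupOf (unitSubgroup K))),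
        (∀ y : unitSubgroup K, j f y = f y) ∧ ∀ γ ∉ unitSubgroup K, j f γ = 0) ∧
      (∀ a : (𝓞 K)⁰, μ (Associates.mk a) =
        (((Real.sqrt (heckeR (integralSubgroup K) (scaling a)))⁻¹ : ℝ) : ℂ) •
          HeckeAlgebra.single (integralSubgroup K) (scaling a)) ∧
      IsStarCrossedProduct.{v} α j μ ∧
      ∃ (CN : Type u) (_ : CStarAlgebra CN) (CΓ : Type u) (_ : CStarAlgebra CΓ)
        (ιN : HeckeAlgebra ((integralSubgroup K).subgroupOf (unitSubgroup K)) →⋆ₐ[ℂ] CN)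
        (ιΓ : HeckeAlgebra (integralSubgroup K) →⋆ₐ[ℂ] CΓ)
        (β : PrincipalIntegralIdeals K →* (CN →⋆ₙₐ[ℂ] CN))
        (i : CN →⋆ₐ[ℂ] CΓ),
        IsEnvelopingCStarAlgebra.{v} ιN ∧ IsEnvelopingCStarAlgebra.{v} ιΓ ∧
        (∀ s f, β s (ιN f) = ιN (α s f)) ∧ (∀ f, i (ιN f) = ιΓ (j f)) ∧
        IsCStarCrossedProduct.{v} β i ((ιΓ : HeckeAlgebra (integralSubgroup K) →* CΓ).comp μ) := by
  have hpair := HeckeAlgebra.isHeckePair_subgroupOf (H := integralSubgroup K) (unitSubgroup K)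
  have h := isHeckeScaling_scalingHom K
  have hbN := h.isCStarBounded_subgroupOf exists_denominatorSubgroup
  obtain ⟨CN, _, ιN, hdN, hpN⟩ := exists_completion_maxCStarSeminorm hbN
  obtain ⟨CΓ, _, ιΓ, hdΓ, hpΓ⟩ := exists_completion_maxCStarSeminorm (h.isCStarBounded hbN)
  obtain ⟨β, hβ⟩ := exists_action_extension hdN hpN h.action
  -- Only the existence of `i` is needed here; the crossed product property does not require knowing
  -- beforehand that it is injective.
  obtain ⟨i, hi⟩ := exists_starAlgHom_extension hdN hpN (ιΓ.comp (HeckeAlgebra.extend h.le))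
  have hcross : IsStarCrossedProduct.{v} h.action (HeckeAlgebra.extend h.le) h.isometry :=
    h.isCovariantGrading.isStarCrossedProduct
  have hΓ : IsEnvelopingCStarAlgebra.{v} ιΓ := isEnvelopingCStarAlgebra_of_cStarSeminorm_le hdΓ hpΓ
  exact ⟨inferInstance, hpair, h.action, HeckeAlgebra.extend h.le, h.isometry, h.action_mk_apply,
    fun f => ⟨HeckeAlgebra.extend_coe h.le f, fun _ => HeckeAlgebra.extend_of_notMem h.le f⟩,
    h.isometry_mk, hcross, CN, inferInstance, CΓ, inferInstance, ιN, ιΓ, β, i,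
    isEnvelopingCStarAlgebra_of_cStarSeminorm_le hdN hpN, hΓ, hβ, hi,
    hcross.isCStarCrossedProduct hdN hΓ hβ hi⟩
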